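/- Let $\Delta=\{\zeta\in\mathbb C:|\zeta-1|<1\}$, and let $A^2(\Delta)$ be the Bergman space of holomorphic functions on $\Delta$ that are square integrable with respect to Lebesgue measure $dA$, with inner product $\langle f,g\rangle_{A^2(\Delta)}=\frac1\pi\iint_\Delta f\,\overline g\,dA$. Let $\mathcal R=\{z:\operatorname{Re}z>0\}$ and $\overline{\mathcal R}=\{z:\operatorname{Re}z\ge 0\}$. For $f\in A^2(\Delta)$ and $z\in\mathcal R$ put $$M_\Delta f(z)=\frac1\pi\iint_\Delta f(\zeta)\,\overline\zeta^{\,z-1}\,dA(\zeta),\qquad F_f(z)=\frac{\Gamma(z+1)}{2^z}\,M_\Delta f(z).$$ Then for every $f\in A^2(\Delta)$ the functions $y\mapsto F_f(x+iy)$ converge in $L^2(\mathbb R)$ as $x\to0^+$; the limit is taken as the definition of $F_f$ on the imaginary axis (up to Lebesgue null sets), so that $F_f$ is defined on $\overline{\mathcal R}$. Moreover, the measure $$\omega=\sum_{n=0}^{\infty}\frac{2^n}{n!}\,\delta_{n/2}(x)\otimes dy\qquad(z=x+iy)$$ is the unique positive Borel measure $\mu$ on $\overline{\mathcal R}$, invariant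 under all translations $z\mapsto z+ic$ with $c\in\mathbb R$, such that for all $f,g\in A^2(\Delta)$ and all Borel representatives of $F_f,F_g$ one has $F_f,F_g\in L^2(\overline{\mathcal R},d\mu)$ and $$\langle f,g\rangle_{A^2(\Delta)}=\frac1{2\pi}\int_{\overline{\mathcal R}}F_f\,\overline{F_g}\,d\mu .$$ That is, $\omega$ has this property, and any such $\mu$ equals $\omega$. -/

import Mathlib

open MeasureTheory Filter Topology
open scoped ENNReal ComplexConjugate Nat

noncomputable section

namespace MellinBergman

/-- The disk `Δ = {ζ : |ζ - 1| < 1}`. -/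
def disk : Set ℂ := Metric.ball 1 1

/-- `f` belongs to the unweighted Bergman space `A²(Δ)`: it is holomorphic and square integrable
on `Δ`. (Values of `f` outside `Δ` are irrelevant.) -/
def IsBergman (f : ℂ → ℂ) : Prop :=
  DifferentiableOn ℂ f disk ∧ MemLp f 2 (volume.restrict disk)

/-- The inner product of `A²(Δ)`, `⟨f, g⟩ = (1/π) ∬_Δ f \bar g dA`. -/
def bergmanInner (f g : ℂ → ℂ) : ℂ :=
  (1 / (Real.pi : ℂ)) * ∫ ζ in disk, f ζ * conj (g ζ)

/-- The Mellin--Bergman transform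
`M_Δ f (z) = (1/π) ∬_Δ f(ζ) \bar ζ^{z-1} dA(ζ)`, meaningful for `Re z > 0`. -/
def mellinBergman (f : ℂ → ℂ) (z : ℂ) : ℂ :=
  (1 / (Real.pi : ℂ)) * ∫ ζ in disk, f ζ * (conj ζ) ^ (z - 1)

/-- `2^{-z} Γ(z+1) M_Δ f (z)`, for `Re z > 0`. -/
def weightedTransform (f : ℂ → ℂ) (z : ℂ) : ℂ :=
  Complex.Gamma (z + 1) / 2 ^ z * mellinBergman f z

/-- The closed right half-plane; as a subtype of `ℂ` it carries its Borel σ-algebra. -/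
abbrev ClosedRHP : Type := {z : ℂ // 0 ≤ z.re}

/-- The point `x + iy` of the closed right half-plane, for `x ≥ 0`. -/
def ClosedRHP.mk' (x : ℝ) (hx : 0 ≤ x) (y : ℝ) : ClosedRHP :=
  ⟨⟨x, y⟩, hx⟩

/-- The translation `z ↦ z + ic` of the closed right half-plane. -/
def ClosedRHP.translate (c : ℝ) (z : ClosedRHP) : ClosedRHP :=
  ClosedRHP.mk' z.1.re z.2 (z.1.im + c)

/-- Invariance of a Borel measure under the translations `z ↦ z + ic`, `c ∈ ℝ`, that is, under all
translations of `ℂ` that map the closed right half-plane onto itself. -/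
def TranslationInvariant (μ : Measure ClosedRHP) : Prop :=
  ∀ c : ℝ, μ.map (ClosedRHP.translate c) = μ

/-- The measure `ω = ∑ₙ (2ⁿ / n!) δ_{n/2}(x) ⊗ dy`; the `n`-th summand is Lebesgue measure `dy`
transported to the line `{n/2 + iy}`. -/
def omega : Measure ClosedRHP :=
  Measure.sum fun n : ℕ =>
    ((2 : ℝ≥0∞) ^ n / (n ! : ℝ≥0∞)) •
      (volume : Measure ℝ).map (ClosedRHP.mk' ((n : ℝ) / 2) (by positivity))

/-- `G` is a (Borel) representative of the extension of `F` (a function on the open right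
half-plane) to the closed half-plane by its boundary values: `G = F` where `Re z > 0`, and
`G(i·)` is the limit of `F(x + i·)` in `L²(ℝ)` as `x → 0⁺`. -/
structure IsBoundaryExtension (F : ℂ → ℂ) (G : ClosedRHP → ℂ) : Prop where
  measurable : Measurable G
  eq_interior : ∀ z : ClosedRHP, 0 < z.1.re → G z = F z.1
  memLp_boundary : MemLp (fun y : ℝ => G (ClosedRHP.mk' 0 le_rfl y)) 2 volume
  tendsto_boundary :
    Tendsto
      (fun x : ℝ =>
        eLpNorm (fun y : ℝ => F ⟨x, y⟩ - G (ClosedRHP.mk' 0 le_rfl y)) 2 volume)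
      (𝓝[>] 0) (𝓝 0)

/-- `f ↦ (2π)^{-1/2} 2^{-z} Γ(z+1) M_Δ f` preserves inner products from `A²(Δ)` into `L²(μ)`, the
functions being defined on the imaginary axis by their boundary values. Those are determined only
up to Lebesgue null sets, and the requirement is independent of the choice. -/
def PreservesInner (μ : Measure ClosedRHP) : Prop :=
  ∀ f g : ℂ → ℂ, IsBergman f → IsBergman g →
    ∀ F G : ClosedRHP → ℂ,
      IsBoundaryExtension (weightedTransform f) F →
      IsBoundaryExtension (weightedTransform g) G →
        MemLp F 2 μ ∧ MemLp G 2 μ ∧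
          bergmanInner f g = (1 / (2 * (Real.pi : ℂ))) * ∫ z, F z * conj (G z) ∂μ

end MellinBergman

end

/-!
Put `t = e^{-2πv}`. The proof represents the Bergman space of `Δ` inside `L²(ℝ, dv)` so that the
weighted transform of `f` on the line `Re z = x` becomes a Fourier transform.

The Bergman kernel `K_w` is sent to `ψ_w = 2π q² t e^{t/2 - q t}`, `q = 1 / conj w`
(`kernelSpectrum`). By Euler's integral (`integral_exp_expParam`) the Gram matrices of the two
families agree up to a factor `2` (`integral_kernelSpectrum_mul_conj`). Since the kernels span
`A²(Δ)` densely (`IsBergman.toLp_mem_kernelSpan`, a consequence of the reproducing property), this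
defines `f ↦ ψ_f` for every Bergman function, and by continuity
`Γ(z + 1) M_Δ f (z) = ∫ e^{-2πvz} e^{-t/2} ψ_f(v) dv` for `Re z > 0` (`exists_spectralMap`).

Hence `F_f(x + iy) = 2^{-iy} 𝓕(2^{-x} t^x e^{-t/2} ψ_f)(y)`. As `x → 0⁺` the function under the
Fourier transform converges in `L²` by dominated convergence, so Plancherel's theorem provides the
boundary values (`IsSpectrum.exists_isBoundaryExtension`). Plancherel's theorem on each line
`Re z = n / 2` together with `∑ₙ (2ⁿ / n!) (2^{-n/2} t^{n/2} e^{-t/2})² = 1` gives the isometry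
for `ω` (`preservesInner_omega`).

For uniqueness let `μ` be any translation invariant measure with the isometry property. The
transform of `K_w` is the explicit function `Γ(z + 1) 2^{-z} (conj w)^{z - 1}`, continuous and
without zeros on the closed half-plane. So `μ` is finite on compact sets, and therefore a product
`ν ⊗ dy` by uniqueness of Haar measure (`TranslationInvariant.eq_map_prod`). For `w = e^{s/2}` with
`0 < w < 2` the isometry prescribes `∫ e^{s x} h(x) dν(x)`, where `h > 0` does not depend on `μ`.
The Laplace transform determines `h ν` (`ext_of_lintegral_exp`), hence `ν` and `μ`. As `ω` has both
properties, `μ = ω`.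
-/

namespace MellinBergman

open scoped FourierTransform

/-! ### The `L²` Fourier transform on integrable functions -/

/-- For an integrable function in `L²(ℝ)` the abstract `L²` Fourier transform is given by the
Fourier integral. Both sides pair in the same way with smooth compactly supported functions. -/
theorem coeFn_fourier_toLp {g : ℝ → ℂ} (h1 : Integrable g) (h2 : MemLp g 2 volume) :
    ((𝓕 (h2.toLp g) : Lp ℂ 2 (volume : Measure ℝ)) : ℝ → ℂ) =ᵐ[volume] 𝓕 g := by
  have hcont : Continuous (𝓕 g) := by
    apply VectorFourier.fourierIntegral_continuous Real.continuous_fourierChar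
      (by exact continuous_inner) h1
  refine ae_eq_of_integral_contDiff_smul_eq
    ((Lp.memLp _).locallyIntegrable (by norm_num)) hcont.locallyIntegrable fun χ hχ hχc => ?_
  have hc' : HasCompactSupport fun x => (χ x : ℂ) := hχc.comp_left (g := Complex.ofReal) rfl
  set s := hc'.toSchwartzMap (Complex.ofRealCLM.contDiff.comp hχ) with hs
  have hsx : ∀ x, s x = (χ x : ℂ) := fun x => rfl
  have e1 : ∫ x, s x • (𝓕 (h2.toLp g) : Lp ℂ 2 (volume : Measure ℝ)) x =
      ∫ x, (𝓕 s) x • (h2.toLp g) x := by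
    have := congrArg (fun T => T s) (Lp.fourier_toTemperedDistribution_eq (h2.toLp g))
    simp only [TemperedDistribution.fourier_apply, Lp.toTemperedDistribution_apply] at this
    exact this.symm
  have e2 : ∫ x, (𝓕 s) x • (h2.toLp g) x = ∫ x, (𝓕 s) x • g x := by
    refine integral_congr_ae ?_
    filter_upwards [h2.coeFn_toLp] with x hx
    rw [hx]
  have e3 : ∫ x, (𝓕 s) x • g x = ∫ x, s x • (𝓕 g) x := by
    have := VectorFourier.integral_fourierIntegral_smul_eq_flip (L := innerₗ ℝ)
      (f := s) (g := g) (μ := volume) (ν := volume) Real.continuous_fourierChar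
      (by exact continuous_inner) s.integrable h1
    rw [flip_innerₗ] at this
    rw [SchwartzMap.fourier_coe]
    exact this
  have e4 := e1.trans (e2.trans e3)
  simpa [hsx] using e4

/-! ### The reproducing property on the unit disk -/

theorem integral_ball_pow_mul_conj_pow_of_ne {m n : ℕ} (hmn : m ≠ n) (r : ℝ) :
    ∫ z in Metric.ball (0 : ℂ) r, z ^ m * conj z ^ n = 0 := by
  -- A rotation `z ↦ c z` multiplies the integral by `c ^ m * conj c ^ n`, which is `-1` here.
  obtain ⟨c, hc⟩ : ∃ c : Circle, (c : ℂ) ^ m * conj (c : ℂ) ^ n = -1 := by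
    have hne : ((m : ℝ) - n) ≠ 0 := sub_ne_zero.mpr (by exact_mod_cast hmn)
    refine ⟨Circle.exp (Real.pi / (m - n)), ?_⟩
    have hne' : ((m : ℂ) - n) ≠ 0 := by exact_mod_cast hne
    rw [Circle.coe_exp, ← Complex.exp_conj, ← Complex.exp_nat_mul, ← Complex.exp_nat_mul,
      ← Complex.exp_add, ← Complex.exp_pi_mul_I]
    congr 1
    simp
    field_simp
    ring
  have hrot : MeasurePreserving (rotation c) (volume : Measure ℂ) volume :=
    (rotation c).measurePreserving
  have h1 := hrot.setIntegral_preimage_emb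
    (rotation c).toHomeomorph.measurableEmbedding
    (fun z => z ^ m * conj z ^ n) (Metric.ball 0 r)
  rw [show (rotation c) ⁻¹' (Metric.ball 0 r) = Metric.ball 0 r by
    ext z; simp only [Set.mem_preimage, mem_ball_zero_iff, LinearIsometryEquiv.norm_map]] at h1
  have h2 : ∀ z : ℂ, (rotation c z) ^ m * conj (rotation c z) ^ n =
      -(z ^ m * conj z ^ n) := fun z => by
    rw [rotation_apply, map_mul, mul_pow, mul_pow, ← neg_one_mul, ← hc]; ring
  simp only [h2, integral_neg] at h1
  exact self_eq_neg.mp h1.symm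

theorem integral_ball_pow_mul_conj_pow_self (n : ℕ) {r : ℝ} (hr : 0 ≤ r) :
    ∫ z in Metric.ball (0 : ℂ) r, z ^ n * conj z ^ n =
      (Real.pi * r ^ (2 * n + 2) / (n + 1) : ℝ) := by
  have h1 : ∀ z : ℂ, z ^ n * conj z ^ n = ((‖z‖ ^ (2 * n) : ℝ) : ℂ) := fun z => by
    rw [← mul_pow, Complex.mul_conj, Complex.normSq_eq_norm_sq]; push_cast; rw [pow_mul]
  simp only [h1]
  rw [integral_complex_ofReal]
  congr 1
  have h2 := MeasureTheory.integral_fun_norm_addHaar (volume : Measure ℂ)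
    (fun y => Set.indicator (Set.Iio r) (fun y => y ^ (2 * n)) y)
  rw [← integral_indicator Metric.isOpen_ball.measurableSet]
  have h3 : (fun z : ℂ => (Metric.ball (0 : ℂ) r).indicator (fun z => ‖z‖ ^ (2 * n)) z) =
      fun z => Set.indicator (Set.Iio r) (fun y => y ^ (2 * n)) ‖z‖ := by
    ext z; simp [Set.indicator]
  rw [h3, h2]
  have h4 : ∫ y in Set.Ioi (0 : ℝ), y ^ (Module.finrank ℝ ℂ - 1) •
      Set.indicator (Set.Iio r) (fun y => y ^ (2 * n)) y = r ^ (2 * n + 2) / (2 * n + 2) := by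
    have : ∀ y : ℝ, y ^ (Module.finrank ℝ ℂ - 1) •
      Set.indicator (Set.Iio r) (fun y => y ^ (2 * n)) y =
        Set.indicator (Set.Iio r) (fun y => y ^ (2 * n + 1)) y := fun y => by
      by_cases hy : y < r <;> simp [Set.indicator, Complex.finrank_real_complex, hy]; ring
    simp only [this]
    rw [setIntegral_indicator measurableSet_Iio, Set.Ioi_inter_Iio,
      ← integral_Ioc_eq_integral_Ioo, ← intervalIntegral.integral_of_le hr, integral_pow]
    simp
    ring_nf
  rw [h4]
  simp [Complex.finrank_real_complex, Measure.real]
  field_simp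

/-- Taylor coefficient at the centre of the disk as a moment over a smaller concentric disk. -/
theorem integral_ball_mul_conj_pow {f : ℂ → ℂ} {a : ℕ → ℂ}
    (hf : ∀ z ∈ Metric.ball (0 : ℂ) 1, HasSum (fun n => a n * z ^ n) (f z)) (n : ℕ) {r : ℝ}
    (hr0 : 0 ≤ r) (hr : r < 1) :
    ∫ z in Metric.ball (0 : ℂ) r, f z * conj z ^ n =
      a n * (Real.pi * r ^ (2 * n + 2) / (n + 1) : ℝ) := by
  have hsum : Summable fun m => ‖a m‖ * r ^ m := by
    have := (hf r (by simpa [abs_of_nonneg hr0] using hr)).summable.norm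
    simpa [abs_of_nonneg hr0] using this
  have hb : ∀ m, ∀ z ∈ Metric.ball (0 : ℂ) r, ‖a m * z ^ m * conj z ^ n‖ ≤ ‖a m‖ * r ^ m := by
    intro m z hz
    have hz' : ‖z‖ ≤ r := by simpa using (Metric.mem_ball.mp hz).le
    rw [norm_mul, norm_mul, norm_pow, norm_pow, RCLike.norm_conj]
    have h1 : ‖z‖ ^ n ≤ 1 := pow_le_one₀ (norm_nonneg _) (hz'.trans hr.le)
    have h2 : ‖z‖ ^ m ≤ r ^ m := by gcongr
    calc _ ≤ ‖a m‖ * ‖z‖ ^ m * 1 := by gcongr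
      _ ≤ _ := by rw [mul_one]; gcongr
  have hint : ∀ m, IntegrableOn (fun z => a m * z ^ m * conj z ^ n) (Metric.ball (0 : ℂ) r) := by
    intro m
    refine Measure.integrableOn_of_bounded (M := ‖a m‖ * r ^ m) measure_ball_lt_top.ne ?_ ?_
    · exact (by fun_prop : Continuous fun z : ℂ => a m * z ^ m * conj z ^ n).aestronglyMeasurable
    · exact (ae_restrict_iff' measurableSet_ball).mpr (ae_of_all _ (hb m))
  have h1 := hasSum_integral_of_summable_integral_norm hint (by
    refine Summable.of_nonneg_of_le (fun m => integral_nonneg fun _ => norm_nonneg _) (fun m => ?_)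
      (hsum.mul_right (volume.real (Metric.ball (0 : ℂ) r)))
    have := norm_setIntegral_le_of_norm_le_const (μ := volume) (s := Metric.ball (0:ℂ) r)
      (f := fun z => ‖a m * z ^ m * conj z ^ n‖) (C := ‖a m‖ * r ^ m) measure_ball_lt_top
      (fun z hz => by simpa using hb m z hz)
    exact (le_abs_self _).trans this)
  have h2 : ∫ z in Metric.ball (0 : ℂ) r, f z * conj z ^ n =
      ∫ z in Metric.ball (0 : ℂ) r, ∑' m, a m * z ^ m * conj z ^ n := by
    refine setIntegral_congr_fun measurableSet_ball fun z hz => ?_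
    exact ((hf z (Metric.ball_subset_ball hr.le hz)).mul_right _).tsum_eq.symm
  rw [h2, ← h1.tsum_eq, tsum_eq_single n]
  · simp_rw [mul_assoc]
    rw [integral_const_mul, integral_ball_pow_mul_conj_pow_self n hr0]
  · intro m hm
    simp_rw [mul_assoc]
    rw [integral_const_mul, integral_ball_pow_mul_conj_pow_of_ne hm, mul_zero]

theorem integral_unitBall_mul_conj_pow {f : ℂ → ℂ} {a : ℕ → ℂ}
    (hf : ∀ z ∈ Metric.ball (0 : ℂ) 1, HasSum (fun n => a n * z ^ n) (f z))
    (hfi : IntegrableOn f (Metric.ball (0 : ℂ) 1)) (n : ℕ) :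
    ∫ z in Metric.ball (0 : ℂ) 1, f z * conj z ^ n = a n * (Real.pi / (n + 1) : ℝ) := by
  have hint : IntegrableOn (fun z => f z * conj z ^ n) (Metric.ball (0 : ℂ) 1) := by
    refine Integrable.mul_bdd (c := 1) hfi
      (by fun_prop : Continuous fun z : ℂ => conj z ^ n).aestronglyMeasurable ?_
    refine (ae_restrict_iff' measurableSet_ball).mpr (ae_of_all _ fun z hz => ?_)
    rw [norm_pow, RCLike.norm_conj]
    exact pow_le_one₀ (norm_nonneg _) (by simpa using (Metric.mem_ball.mp hz).le)
  let r : ℕ → ℝ := fun k => 1 - 1 / ((k : ℝ) + 1)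
  have hr0 : ∀ k, 0 ≤ r k := fun k => by
    have : 1 / ((k : ℝ) + 1) ≤ 1 := by
      rw [div_le_one (by positivity)]; linarith [k.cast_nonneg (α := ℝ)]
    simp only [r]; linarith
  have hr1 : ∀ k, r k < 1 := fun k => by
    have : 0 < 1 / ((k : ℝ) + 1) := by positivity
    simp only [r]; linarith
  have hr : Tendsto r atTop (𝓝 1) := by
    simpa [r] using (tendsto_one_div_add_atTop_nhds_zero_nat (𝕜 := ℝ)).const_sub 1
  have hmono : Monotone fun k => Metric.ball (0 : ℂ) (r k) := by
    intro k l hkl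
    refine Metric.ball_subset_ball ?_
    have hkl' : (k : ℝ) ≤ l := by exact_mod_cast hkl
    simp only [r]
    gcongr
  have hU : ⋃ k, Metric.ball (0 : ℂ) (r k) = Metric.ball 0 1 := by
    ext z
    simp only [Set.mem_iUnion, Metric.mem_ball]
    refine ⟨fun ⟨k, hk⟩ => hk.trans (hr1 k), fun hz => ?_⟩
    exact (hr.eventually (lt_mem_nhds hz)).exists
  have h1 := tendsto_setIntegral_of_monotone (μ := volume)
    (f := fun z : ℂ => f z * conj z ^ n) (fun k => measurableSet_ball) hmono (by rwa [hU])
  rw [hU] at h1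
  refine tendsto_nhds_unique h1 ?_
  simp only [integral_ball_mul_conj_pow hf n (hr0 _) (hr1 _)]
  have h2 : Tendsto (fun k => a n * (Real.pi * r k ^ (2 * n + 2) / (n + 1) : ℝ)) atTop
      (𝓝 (a n * (Real.pi * 1 ^ (2 * n + 2) / (n + 1) : ℝ))) :=
    tendsto_const_nhds.mul ((Complex.continuous_ofReal.tendsto _).comp
      (((hr.pow _).const_mul _).div_const _))
  simpa using h2

/-- Reproducing property of the Bergman kernel of the unit disk. -/
theorem integral_unitBall_mul_kernel {f : ℂ → ℂ}
    (hf : DifferentiableOn ℂ f (Metric.ball 0 1))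
    (hfi : IntegrableOn f (Metric.ball (0 : ℂ) 1)) {w : ℂ} (hw : ‖w‖ < 1) :
    ∫ z in Metric.ball (0 : ℂ) 1, f z * (1 / (1 - w * conj z) ^ 2) = Real.pi * f w := by
  obtain ⟨a, ha⟩ : ∃ a : ℕ → ℂ, ∀ z ∈ Metric.ball (0 : ℂ) 1,
      HasSum (fun n => a n * z ^ n) (f z) := by
    refine ⟨fun n => (n ! : ℂ)⁻¹ * iteratedDeriv n f 0, fun z hz => ?_⟩
    have := Complex.hasSum_taylorSeries_on_ball hf hz
    simpa [mul_comm, mul_left_comm] using this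
  have hgeom : ∀ z ∈ Metric.ball (0 : ℂ) 1,
      HasSum (fun n : ℕ => f z * (((n : ℂ) + 1) * w ^ n * conj z ^ n))
        (f z * (1 / (1 - w * conj z) ^ 2)) := by
    intro z hz
    have hz' : ‖z‖ < 1 := by simpa using hz
    have h : ‖w * conj z‖ < 1 := by
      rw [norm_mul, RCLike.norm_conj]
      exact mul_lt_one_of_nonneg_of_lt_one_left (norm_nonneg _) hw hz'.le
    have := (hasSum_choose_mul_geometric_of_norm_lt_one 1 h).mul_left (f z)
    simpa [mul_pow, mul_assoc] using this
  have hsum : Summable fun n : ℕ => ((n : ℝ) + 1) * ‖w‖ ^ n := by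
    have := (hasSum_choose_mul_geometric_of_norm_lt_one (𝕜 := ℝ) 1
      (r := ‖w‖) (by simpa using hw)).summable
    simpa using this
  have hb : ∀ n : ℕ, ∀ z ∈ Metric.ball (0 : ℂ) 1,
      ‖((n : ℂ) + 1) * w ^ n * conj z ^ n‖ ≤ ((n : ℝ) + 1) * ‖w‖ ^ n := by
    intro n z hz
    have h1 : ‖z‖ ^ n ≤ 1 := pow_le_one₀ (norm_nonneg _) (by simpa using (Metric.mem_ball.mp hz).le)
    rw [norm_mul, norm_mul, norm_pow, norm_pow, RCLike.norm_conj,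
      show ((n : ℂ) + 1) = ((n + 1 : ℕ) : ℂ) by push_cast; rfl, Complex.norm_natCast]
    push_cast
    exact mul_le_of_le_one_right (by positivity) h1
  have hint : ∀ n : ℕ, IntegrableOn (fun z => f z * (((n : ℂ) + 1) * w ^ n * conj z ^ n))
      (Metric.ball (0 : ℂ) 1) := fun n => by
    refine Integrable.mul_bdd (c := ((n : ℝ) + 1) * ‖w‖ ^ n) hfi
      (by fun_prop : Continuous fun z : ℂ =>
        ((n : ℂ) + 1) * w ^ n * conj z ^ n).aestronglyMeasurable ?_
    exact (ae_restrict_iff' measurableSet_ball).mpr (ae_of_all _ (hb n))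
  have h1 := hasSum_integral_of_summable_integral_norm hint (by
    refine Summable.of_nonneg_of_le (fun m => integral_nonneg fun _ => norm_nonneg _) (fun n => ?_)
      (hsum.mul_right (∫ z in Metric.ball (0 : ℂ) 1, ‖f z‖))
    rw [← integral_const_mul]
    refine setIntegral_mono_on (hint n).norm (hfi.norm.const_mul _) measurableSet_ball
      fun z hz => ?_
    rw [norm_mul, mul_comm]
    gcongr
    exact hb n z hz)
  have h2 : ∫ z in Metric.ball (0 : ℂ) 1, f z * (1 / (1 - w * conj z) ^ 2) =
      ∫ z in Metric.ball (0 : ℂ) 1, ∑' n : ℕ, f z * (((n : ℂ) + 1) * w ^ n * conj z ^ n) :=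
    setIntegral_congr_fun measurableSet_ball fun z hz => (hgeom z hz).tsum_eq.symm
  rw [h2, ← h1.tsum_eq, ← (ha w (by simpa using hw)).tsum_eq, ← tsum_mul_left]
  congr 1 with n
  have h3 : ∀ z : ℂ, f z * (((n : ℂ) + 1) * w ^ n * conj z ^ n) =
      (((n : ℂ) + 1) * w ^ n) * (f z * conj z ^ n) := fun z => by ring
  simp only [h3]
  rw [integral_const_mul, integral_unitBall_mul_conj_pow ha hfi]
  have : (n : ℂ) + 1 ≠ 0 := by exact_mod_cast n.succ_ne_zero
  push_cast
  field_simp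

/-! ### Density of the Bergman kernels -/

/-- A family in a Hilbert space is carried to any family with proportional Gram matrix by a bounded
linear map, which multiplies inner products on the closed span by the same factor. -/
theorem exists_clm_of_gram {ι E H : Type*} [NormedAddCommGroup E] [InnerProductSpace ℂ E]
    [CompleteSpace E] [NormedAddCommGroup H] [InnerProductSpace ℂ H] [CompleteSpace H]
    (k : ι → E) (ψ : ι → H) {c : ℝ} (hc : 0 ≤ c)
    (h : ∀ i j, inner ℂ (ψ i) (ψ j) = (c : ℂ) * inner ℂ (k i) (k j)) :
    ∃ J : E →L[ℂ] H, (∀ i, J (k i) = ψ i) ∧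
      ∀ x ∈ (Submodule.span ℂ (Set.range k)).topologicalClosure,
      ∀ y ∈ (Submodule.span ℂ (Set.range k)).topologicalClosure,
        inner ℂ (J x) (J y) = (c : ℂ) * inner ℂ x y := by
  set S := Submodule.span ℂ (Set.range k) with hS
  set P := S.topologicalClosure with hP
  have hkS : ∀ i, k i ∈ S := fun i => Submodule.subset_span ⟨i, rfl⟩
  let A := Finsupp.linearCombination ℂ k
  let B := Finsupp.linearCombination ℂ ψ
  have hA : ∀ a, A a ∈ P := fun a => S.le_topologicalClosure <| by
    rw [hS, ← Finsupp.range_linearCombination]; exact ⟨a, rfl⟩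
  let e : (ι →₀ ℂ) →ₗ[ℂ] P := A.codRestrict P hA
  have hAB : ∀ a b, inner ℂ (B a) (B b) = (c : ℂ) * inner ℂ (A a) (A b) := by
    intro a b
    simp only [A, B, Finsupp.linearCombination_apply, Finsupp.sum, sum_inner, inner_sum,
      inner_smul_left, inner_smul_right, h, Finset.mul_sum]
    refine Finset.sum_congr rfl fun i _ => Finset.sum_congr rfl fun j _ => by ring
  have hnorm : ∀ a, ‖B a‖ ≤ Real.sqrt c * ‖e a‖ := by
    intro a
    have h1 : ‖B a‖ ^ 2 = c * ‖A a‖ ^ 2 := by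
      have := hAB a a
      rw [inner_self_eq_norm_sq_to_K, inner_self_eq_norm_sq_to_K] at this
      simp only [Complex.coe_algebraMap] at this
      exact_mod_cast this
    have h2 : ‖e a‖ = ‖A a‖ := rfl
    rw [h2, ← Real.sqrt_sq (norm_nonneg (B a)), h1, Real.sqrt_mul hc,
      Real.sqrt_sq (norm_nonneg _)]
  have hdense : DenseRange e := by
    rw [DenseRange, dense_iff_closure_eq, Set.eq_univ_iff_forall]
    intro x
    have hx : (x : E) ∈ closure (S : Set E) := x.2
    rw [closure_subtype]
    convert hx using 2
    ext y
    constructor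
    · rintro ⟨_, ⟨a, rfl⟩, rfl⟩
      change A a ∈ (S : Set E)
      rw [hS, ← Finsupp.range_linearCombination]; exact ⟨a, rfl⟩
    · intro hy
      rw [hS, ← Finsupp.range_linearCombination] at hy
      obtain ⟨a, rfl⟩ := hy
      exact ⟨e a, ⟨a, rfl⟩, rfl⟩
  let J₀ : P →L[ℂ] H := B.extendOfNorm e
  have hJ₀ : ∀ a, J₀ (e a) = B a := fun a =>
    LinearMap.extendOfNorm_eq hdense ⟨_, hnorm⟩ a
  have hJin : ∀ x y : P, inner ℂ (J₀ x) (J₀ y) = (c : ℂ) * inner ℂ (x : E) (y : E) := by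
    intro x y
    refine hdense.induction_on₂ (p := fun x y : P =>
      inner ℂ (J₀ x) (J₀ y) = (c : ℂ) * inner ℂ (x : E) (y : E)) ?_ ?_ x y
    · exact isClosed_eq (by fun_prop) (by fun_prop)
    · intro a b
      rw [hJ₀, hJ₀, hAB]
      rfl
  have hproj : ∀ x (hx : x ∈ P), P.orthogonalProjectionOnto x = ⟨x, hx⟩ := fun x hx =>
    Submodule.orthogonalProjectionOnto_mem_subspace_eq_self (K := P) ⟨x, hx⟩
  refine ⟨J₀ ∘L P.orthogonalProjectionOnto, fun i => ?_, fun x hx y hy => ?_⟩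
  · rw [ContinuousLinearMap.comp_apply, hproj _ (S.le_topologicalClosure (hkS i))]
    have : (⟨k i, S.le_topologicalClosure (hkS i)⟩ : P) = e (Finsupp.single i 1) := by
      ext; simp [e, A]
    rw [this, hJ₀]; simp [B]
  · rw [ContinuousLinearMap.comp_apply, ContinuousLinearMap.comp_apply, hproj _ hx, hproj _ hy,
      hJin]

theorem measurableSet_disk : MeasurableSet disk := measurableSet_ball

instance : IsFiniteMeasure (volume.restrict disk) :=
  ⟨by rw [Measure.restrict_apply_univ]; exact measure_ball_lt_top⟩

/-- The Bergman kernel `K_w` of the disk `Δ`, as a function of its holomorphic variable `ζ`. -/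
noncomputable def bergmanKernel (w ζ : ℂ) : ℂ := 1 / (ζ + conj w - ζ * conj w) ^ 2

theorem bergmanKernel_eq (w ζ : ℂ) :
    bergmanKernel w ζ = 1 / (1 - (ζ - 1) * conj (w - 1)) ^ 2 := by
  rw [bergmanKernel, map_sub, map_one]; congr 2; ring

theorem conj_bergmanKernel (w ζ : ℂ) : conj (bergmanKernel w ζ) = bergmanKernel ζ w := by
  simp only [bergmanKernel, map_div₀, map_one, map_pow, map_sub, map_add, map_mul,
    Complex.conj_conj]
  congr 2; ring

theorem norm_one_sub_mul_conj_ge {w ζ : ℂ} (hζ : ζ ∈ disk) :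
    1 - ‖w - 1‖ ≤ ‖1 - (ζ - 1) * conj (w - 1)‖ := by
  have h1 : ‖ζ - 1‖ ≤ 1 := by simpa [disk, dist_eq_norm] using (Metric.mem_ball.mp hζ).le
  have h2 : ‖(ζ - 1) * conj (w - 1)‖ ≤ ‖w - 1‖ := by
    rw [norm_mul, RCLike.norm_conj]
    exact mul_le_of_le_one_left (norm_nonneg _) h1
  have h3 := norm_sub_norm_le (1 : ℂ) ((ζ - 1) * conj (w - 1))
  rw [norm_one] at h3
  linarith

theorem isBergman_bergmanKernel {w : ℂ} (hw : w ∈ disk) : IsBergman (bergmanKernel w) := by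
  have hw' : 0 < 1 - ‖w - 1‖ := by
    have : ‖w - 1‖ < 1 := by simpa [disk, dist_eq_norm] using hw
    linarith
  have hd : DifferentiableOn ℂ (bergmanKernel w) disk := by
    have : bergmanKernel w = fun ζ => 1 / (1 - (ζ - 1) * conj (w - 1)) ^ 2 :=
      funext fun ζ => bergmanKernel_eq w ζ
    rw [this]
    refine DifferentiableOn.div (by fun_prop) (by fun_prop) fun ζ hζ => ?_
    exact pow_ne_zero _ (norm_pos_iff.mp (hw'.trans_le (norm_one_sub_mul_conj_ge hζ)))
  refine ⟨hd, MemLp.of_bound (C := 1 / (1 - ‖w - 1‖) ^ 2)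
    (hd.continuousOn.aestronglyMeasurable measurableSet_disk) ?_⟩
  refine (ae_restrict_iff' measurableSet_disk).mpr (ae_of_all _ fun ζ hζ => ?_)
  rw [bergmanKernel_eq, norm_div, norm_one, norm_pow]
  gcongr
  exact norm_one_sub_mul_conj_ge hζ

theorem IsBergman.integrableOn {f : ℂ → ℂ} (hf : IsBergman f) : IntegrableOn f disk :=
  hf.2.integrable (by norm_num)

/-- Reproducing property of the Bergman kernel of `Δ`. -/
theorem IsBergman.integral_mul_conj_kernel {f : ℂ → ℂ} (hf : IsBergman f) {w : ℂ}
    (hw : w ∈ disk) : ∫ ζ in disk, f ζ * conj (bergmanKernel w ζ) = Real.pi * f w := by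
  have hmp : MeasurePreserving (fun z : ℂ => 1 + z) volume volume := measurePreserving_add_left _ 1
  have hemb : MeasurableEmbedding (fun z : ℂ => 1 + z) := measurableEmbedding_addLeft 1
  have hpre : (fun z : ℂ => 1 + z) ⁻¹' disk = Metric.ball 0 1 := by
    ext z; simp [disk, dist_eq_norm]
  rw [← hmp.setIntegral_preimage_emb hemb, hpre]
  have hfi : IntegrableOn (fun z => f (1 + z)) (Metric.ball (0 : ℂ) 1) := by
    rw [← hpre]
    exact (hmp.integrableOn_comp_preimage hemb).mpr hf.integrableOn
  have hd : DifferentiableOn ℂ (fun z => f (1 + z)) (Metric.ball 0 1) := by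
    refine hf.1.comp (by fun_prop) fun z hz => ?_
    rw [← hpre] at hz; exact hz
  have := integral_unitBall_mul_kernel hd hfi (w := w - 1)
    (by simpa [disk, dist_eq_norm] using hw)
  simp only [add_sub_cancel] at this
  rw [← this]
  refine integral_congr_ae (ae_of_all _ fun z => ?_)
  beta_reduce
  rw [conj_bergmanKernel, bergmanKernel_eq, add_sub_cancel_left]

/-- The Hilbert space `L²(Δ)`; its inner product is `π` times the normalized one. -/
abbrev L2Disk : Type := Lp ℂ 2 (volume.restrict disk)

/-- The Bergman kernels as elements of `L²(Δ)`. -/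
noncomputable def kernelLp (w : disk) : L2Disk := (isBergman_bergmanKernel w.2).2.toLp _

theorem inner_toLp_toLp {f g : ℂ → ℂ} (hf : MemLp f 2 (volume.restrict disk))
    (hg : MemLp g 2 (volume.restrict disk)) :
    inner ℂ (hf.toLp f) (hg.toLp g) = ∫ ζ in disk, g ζ * conj (f ζ) := by
  rw [L2.inner_def]
  refine integral_congr_ae ?_
  filter_upwards [hf.coeFn_toLp, hg.coeFn_toLp] with ζ h1 h2
  rw [h1, h2, RCLike.inner_apply]

theorem inner_kernelLp {f : ℂ → ℂ} (hf : IsBergman f) (w : disk) :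
    inner ℂ (kernelLp w) (hf.2.toLp f) = Real.pi * f w := by
  rw [kernelLp, inner_toLp_toLp, hf.integral_mul_conj_kernel w.2]

/-- The closed span of the Bergman kernels in `L²(Δ)`. -/
noncomputable def kernelSpan : Submodule ℂ L2Disk :=
  (Submodule.span ℂ (Set.range kernelLp)).topologicalClosure

/-- Elements of the closed span of the kernels are reproduced by the kernels, almost everywhere:
this property is linear and passes to `L²` limits along an a.e. convergent subsequence. -/
theorem ae_eq_inner_of_mem_kernelSpan {g : L2Disk} (hg : g ∈ kernelSpan) :
    ∀ᵐ w ∂(volume.restrict disk), ∀ h : w ∈ disk,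
      inner ℂ (kernelLp ⟨w, h⟩) g = Real.pi * g w := by
  have hspan : ∀ g ∈ Submodule.span ℂ (Set.range kernelLp),
      ∀ᵐ w ∂(volume.restrict disk), ∀ h : w ∈ disk,
        inner ℂ (kernelLp ⟨w, h⟩) g = Real.pi * g w := by
    intro g hg
    induction hg using Submodule.span_induction with
    | mem x hx =>
      obtain ⟨v, rfl⟩ := hx
      filter_upwards [(isBergman_bergmanKernel v.2).2.coeFn_toLp] with w hw h
      rw [show (kernelLp v) w = bergmanKernel v w from hw]
      exact inner_kernelLp (isBergman_bergmanKernel v.2) ⟨w, h⟩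
    | zero =>
      filter_upwards [Lp.coeFn_zero ℂ 2 (volume.restrict disk)] with w hw h
      rw [hw, inner_zero_right, Pi.zero_apply, mul_zero]
    | add x y _ _ hx hy =>
      filter_upwards [hx, hy, Lp.coeFn_add x y] with w h1 h2 h3 h
      rw [inner_add_right, h1 h, h2 h, h3, Pi.add_apply, mul_add]
    | smul a x _ hx =>
      filter_upwards [hx, Lp.coeFn_smul a x] with w h1 h3 h
      rw [inner_smul_right, h1 h, h3, Pi.smul_apply, smul_eq_mul]; ring
  obtain ⟨u, hu, hlim⟩ := mem_closure_iff_seq_limit.mp hg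
  obtain ⟨ns, hns, hae⟩ := (tendstoInMeasure_of_tendsto_Lp hlim).exists_seq_tendsto_ae
  have hall : ∀ᵐ w ∂(volume.restrict disk), ∀ n, ∀ h : w ∈ disk,
      inner ℂ (kernelLp ⟨w, h⟩) (u n) = Real.pi * (u n) w :=
    ae_all_iff.mpr fun n => hspan _ (hu n)
  filter_upwards [hae, hall] with w h1 h2 h
  refine tendsto_nhds_unique
    ((tendsto_const_nhds.inner (hlim.comp hns.tendsto_atTop))) ?_
  simp only [Function.comp_def, h2 _ h]
  exact tendsto_const_nhds.mul h1

/-- The Bergman kernels span a dense subspace of `A²(Δ)`. -/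
theorem IsBergman.toLp_mem_kernelSpan {f : ℂ → ℂ} (hf : IsBergman f) :
    hf.2.toLp f ∈ kernelSpan := by
  have : CompleteSpace kernelSpan := by unfold kernelSpan; infer_instance
  set F := hf.2.toLp f with hF
  set g : L2Disk := kernelSpan.starProjection F with hg
  have hgP : g ∈ kernelSpan := Submodule.starProjection_apply_mem _ _
  have hperp : ∀ w : disk, inner ℂ (kernelLp w) F = inner ℂ (kernelLp w) g := by
    intro w
    have hk : kernelLp w ∈ kernelSpan :=
      Submodule.le_topologicalClosure _ (Submodule.subset_span ⟨w, rfl⟩)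
    have := (Submodule.sub_starProjection_mem_orthogonal (K := kernelSpan) F) _ hk
    rw [inner_sub_right, sub_eq_zero] at this
    exact this
  have : F = g := by
    refine Lp.ext ?_
    filter_upwards [ae_eq_inner_of_mem_kernelSpan hgP, hf.2.coeFn_toLp,
      ae_restrict_mem measurableSet_disk] with w h1 h2 hw
    have h3 := h1 hw
    rw [← hperp, inner_kernelLp hf ⟨w, hw⟩] at h3
    rw [h2]
    exact mul_left_cancel₀ (by exact_mod_cast Real.pi_ne_zero) h3
  rw [this]
  exact hgP

/-! ### The spectral map from the Bergman space to `L²(ℝ)` -/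

/-- The decreasing parametrization `v ↦ e^{-2πv}` of `(0, ∞)`. The factor `2π` makes the Mellin
transform on vertical lines equal to the Fourier transform in Mathlib's normalization. -/
noncomputable def expParam (v : ℝ) : ℝ := Real.exp (-(2 * Real.pi * v))

theorem expParam_pos (v : ℝ) : 0 < expParam v := Real.exp_pos _

theorem continuous_expParam : Continuous expParam := by unfold expParam; fun_prop

theorem hasDerivAt_expParam (v : ℝ) :
    HasDerivAt expParam (-(2 * Real.pi * expParam v)) v := by
  have h : HasDerivAt (fun v : ℝ => -(2 * Real.pi * v)) (-(2 * Real.pi * 1)) v :=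
    ((hasDerivAt_id v).const_mul (2 * Real.pi)).neg
  have h2 := h.exp
  rw [show Real.exp (-(2 * Real.pi * v)) * -(2 * Real.pi * 1) = -(2 * Real.pi * expParam v) by
    rw [expParam]; ring] at h2
  exact h2

theorem expParam_injective : Function.Injective expParam := by
  intro a b h
  have h1 := Real.exp_injective h
  have h2 := Real.pi_pos
  nlinarith [mul_left_cancel₀ (by positivity : (2 * Real.pi) ≠ 0) (neg_injective h1)]

theorem range_expParam : expParam '' Set.univ = Set.Ioi 0 := by
  ext t
  constructor
  · rintro ⟨v, -, rfl⟩; exact expParam_pos v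
  · intro ht
    refine ⟨-(Real.log t / (2 * Real.pi)), trivial, ?_⟩
    rw [expParam, mul_neg, neg_neg, mul_div_cancel₀ _ (by positivity), Real.exp_log ht]

theorem abs_deriv_expParam (v : ℝ) :
    |(-(2 * Real.pi * expParam v))| = 2 * Real.pi * expParam v := by
  rw [abs_neg, abs_of_pos]
  have := expParam_pos v
  positivity

theorem integral_comp_expParam (g : ℝ → ℂ) :
    ∫ v, (2 * Real.pi * expParam v) • g (expParam v) = ∫ t in Set.Ioi 0, g t := by
  have := integral_image_eq_integral_abs_deriv_smul MeasurableSet.univ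
    (fun v _ => (hasDerivAt_expParam v).hasDerivWithinAt) expParam_injective.injOn g
  rw [range_expParam] at this
  rw [this, setIntegral_univ]
  simp only [abs_deriv_expParam]

theorem integrable_comp_expParam {g : ℝ → ℂ} (hg : IntegrableOn g (Set.Ioi 0)) :
    Integrable fun v => (2 * Real.pi * expParam v) • g (expParam v) := by
  have := integrableOn_image_iff_integrableOn_abs_deriv_smul MeasurableSet.univ
    (fun v _ => (hasDerivAt_expParam v).hasDerivWithinAt) expParam_injective.injOn g
  rw [range_expParam] at this
  have h := this.mp hg
  rw [integrableOn_univ] at h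
  simpa only [abs_deriv_expParam] using h

theorem expParam_smul_cpow_mul_exp (a r : ℂ) (v : ℝ) :
    (2 * Real.pi * expParam v) • ((expParam v : ℂ) ^ (a - 1) * Complex.exp (-(r * expParam v))) =
      (2 * Real.pi) * Complex.exp (-(2 * Real.pi * v) * a - r * expParam v) := by
  have h0 : (expParam v : ℂ) ≠ 0 := by exact_mod_cast (expParam_pos v).ne'
  rw [Complex.cpow_sub _ _ h0, Complex.cpow_one, Complex.cpow_def_of_ne_zero h0,
    ← Complex.ofReal_log (expParam_pos v).le, expParam, Real.log_exp, ← expParam, sub_eq_add_neg,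
    Complex.exp_add, Complex.real_smul]
  push_cast
  field_simp

theorem integrable_exp_expParam {a r : ℂ} (ha : 0 < a.re) (hr : 0 < r.re) :
    Integrable fun v : ℝ => Complex.exp (-(2 * Real.pi * v) * a - r * expParam v) := by
  have h1 : IntegrableOn (fun t : ℝ => (t : ℂ) ^ (a - 1) * Complex.exp (-(r * t)))
      (Set.Ioi 0) := by
    have h2 := integrableOn_rpow_mul_exp_neg_mul_rpow (p := 1) (s := a.re - 1) (b := r.re)
      (by linarith) one_pos hr
    refine h2.mono' ?_ ?_
    · refine ContinuousOn.aestronglyMeasurable (fun t ht => ?_) measurableSet_Ioi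
      refine ContinuousAt.continuousWithinAt (ContinuousAt.mul ?_ (by fun_prop))
      exact (Complex.continuousAt_ofReal_cpow_const _ _ (Or.inr (ne_of_gt ht)))
    · refine (ae_restrict_iff' measurableSet_Ioi).mpr (ae_of_all _ fun t ht => ?_)
      rw [norm_mul, Complex.norm_cpow_eq_rpow_re_of_pos ht, Complex.norm_exp]
      simp
  have h3 := (integrable_comp_expParam h1).const_mul ((2 * Real.pi : ℂ)⁻¹)
  refine h3.congr (ae_of_all _ fun v => ?_)
  beta_reduce
  rw [expParam_smul_cpow_mul_exp, inv_mul_cancel_left₀]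
  exact_mod_cast (by positivity : (2 * Real.pi) ≠ 0)

theorem differentiableOn_integral_exp_expParam {a : ℂ} (ha : 0 < a.re) :
    DifferentiableOn ℂ (fun r : ℂ =>
      ∫ v : ℝ, Complex.exp (-(2 * Real.pi * v) * a - r * expParam v)) {r | 0 < r.re} := by
  intro r₀ hr₀
  have hr₀' : 0 < r₀.re := hr₀
  have hc := continuous_expParam
  set δ : ℝ := r₀.re / 2
  have hδ : 0 < δ := half_pos hr₀'
  have hs : {r : ℂ | δ < r.re} ∈ 𝓝 r₀ :=
    (isOpen_lt continuous_const Complex.continuous_re).mem_nhds (half_lt_self hr₀')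
  have h := hasDerivAt_integral_of_dominated_loc_of_deriv_le (μ := volume) (x₀ := r₀)
    (F := fun (r : ℂ) (v : ℝ) => Complex.exp (-(2 * Real.pi * v) * a - r * expParam v))
    (F' := fun (r : ℂ) (v : ℝ) =>
      -expParam v * Complex.exp (-(2 * Real.pi * v) * a - r * expParam v))
    (bound := fun v => ‖Complex.exp (-(2 * Real.pi * v) * (a + 1) - (δ : ℂ) * expParam v)‖)
    hs (Eventually.of_forall fun r => by fun_prop) (integrable_exp_expParam ha hr₀')
    (by fun_prop) (ae_of_all _ fun v r hr => ?_)
    (integrable_exp_expParam (by rw [Complex.add_re, Complex.one_re]; linarith)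
      (by simpa using hδ)).norm
    (ae_of_all _ fun v r _ => ?_)
  · exact h.2.differentiableAt.differentiableWithinAt
  · have hT := expParam_pos v
    have hr' : δ < r.re := hr
    rw [norm_mul, norm_neg, Complex.norm_real, Real.norm_of_nonneg hT.le, Complex.norm_exp,
      Complex.norm_exp]
    nth_rewrite 1 [expParam]
    rw [← Real.exp_add, Real.exp_le_exp]
    simp
    nlinarith
  · have h1 : HasDerivAt (fun r : ℂ => -(2 * Real.pi * v) * a - r * expParam v)
        (-(1 * expParam v)) r := ((hasDerivAt_id r).mul_const _).const_sub _
    have h2 := h1.cexp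
    rw [one_mul, mul_comm (Complex.exp _)] at h2
    exact h2

/-- Euler's integral for `Γ` in the variable `v`. It is known for real `r > 0`, and both sides are
holomorphic in `r` on the right half-plane. -/
theorem integral_exp_expParam {a r : ℂ} (ha : 0 < a.re) (hr : 0 < r.re) :
    (2 * Real.pi) * ∫ v : ℝ, Complex.exp (-(2 * Real.pi * v) * a - r * expParam v) =
      (1 / r) ^ a * Complex.Gamma a := by
  have hopen : IsOpen {r : ℂ | 0 < r.re} := isOpen_lt continuous_const Complex.continuous_re
  have hl := ((differentiableOn_integral_exp_expParam ha).const_mul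
    (2 * Real.pi : ℂ)).analyticOnNhd hopen
  have hrr : AnalyticOnNhd ℂ (fun r : ℂ => (1 / r) ^ a * Complex.Gamma a) {r | 0 < r.re} := by
    refine DifferentiableOn.analyticOnNhd (fun r hr => ?_) hopen
    have hr' : 0 < r.re := hr
    have h0 : r ≠ 0 := by rintro rfl; simp at hr'
    refine (DifferentiableAt.mul_const ?_ _).differentiableWithinAt
    refine DifferentiableAt.cpow_const ((differentiableAt_const _).div differentiableAt_id h0)
      (Or.inl ?_)
    rw [one_div, Complex.inv_re]
    exact div_pos hr' (Complex.normSq_pos.mpr h0)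
  refine AnalyticOnNhd.eqOn_of_preconnected_of_frequently_eq hl hrr
    ((convex_halfSpace_re_gt 0).isPreconnected) (z₀ := 1) (by simp) ?_ hr
  have hreal : ∀ s : ℝ, 0 < s →
      (2 * Real.pi) * ∫ v : ℝ, Complex.exp (-(2 * Real.pi * v) * a - s * expParam v) =
        (1 / s) ^ a * Complex.Gamma a := by
    intro s hs
    rw [← Complex.integral_cpow_mul_exp_neg_mul_Ioi ha hs, ← integral_comp_expParam,
      ← integral_const_mul]
    simp only [expParam_smul_cpow_mul_exp]
  rw [frequently_iff_seq_forall]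
  refine ⟨fun n : ℕ => ((1 + 1 / ((n : ℝ) + 1) : ℝ) : ℂ), ?_, fun n => ?_⟩
  · rw [tendsto_nhdsWithin_iff]
    constructor
    · have := (tendsto_one_div_add_atTop_nhds_zero_nat (𝕜 := ℝ)).const_add 1
      rw [add_zero] at this
      exact (Complex.continuous_ofReal.tendsto 1).comp this
    · refine Eventually.of_forall fun n => ?_
      have : (0 : ℝ) < 1 / ((n : ℝ) + 1) := by positivity
      rw [Set.mem_compl_singleton_iff, Ne, ← Complex.ofReal_one, Complex.ofReal_inj]
      linarith
  · exact hreal _ (by positivity)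

theorem ne_zero_of_mem_disk {w : ℂ} (hw : w ∈ disk) : w ≠ 0 := by
  rintro rfl
  simp [disk] at hw

theorem normSq_lt_of_mem_disk {w : ℂ} (hw : w ∈ disk) : Complex.normSq w < 2 * w.re := by
  have h1 : ‖w - 1‖ < 1 := by simpa [disk, dist_eq_norm] using hw
  have h2 : Complex.normSq (w - 1) < 1 := by
    rw [Complex.normSq_eq_norm_sq]; exact pow_lt_one₀ (norm_nonneg _) h1 two_ne_zero
  simp only [Complex.normSq_apply, Complex.sub_re, Complex.sub_im, Complex.one_re,
    Complex.one_im] at h2 ⊢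
  nlinarith

theorem re_pos_of_mem_disk {w : ℂ} (hw : w ∈ disk) : 0 < w.re := by
  have := normSq_lt_of_mem_disk hw
  linarith [Complex.normSq_nonneg w]

/-- Inversion maps `Δ` into the half-plane `Re > 1/2`. -/
theorem half_lt_re_inv {w : ℂ} (hw : w ∈ disk) : 1 / 2 < (w⁻¹).re := by
  rw [Complex.inv_re, lt_div_iff₀ (Complex.normSq_pos.mpr (ne_zero_of_mem_disk hw))]
  linarith [normSq_lt_of_mem_disk hw]

/-- The function in `L²(ℝ)` that corresponds to the Bergman kernel `K_w`. In the variable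
`t = e^{-2πv}` and with `q = 1 / conj w` it is `2π q² t e^{t/2 - q t}`. -/
noncomputable def kernelSpectrum (w : ℂ) (v : ℝ) : ℂ :=
  2 * Real.pi * ((conj w)⁻¹ ^ 2 *
    Complex.exp (-(2 * Real.pi * v) * 1 - ((conj w)⁻¹ - 1 / 2) * expParam v))

theorem continuous_kernelSpectrum (w : ℂ) : Continuous (kernelSpectrum w) := by
  have := continuous_expParam
  unfold kernelSpectrum; fun_prop

theorem kernelSpectrum_mul_conj (u w : ℂ) (v : ℝ) :
    kernelSpectrum u v * conj (kernelSpectrum w v) =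
      (2 * Real.pi * ((conj u)⁻¹ * w⁻¹) ^ 2) * ((2 * Real.pi) *
        Complex.exp (-(2 * Real.pi * v) * 2 - ((conj u)⁻¹ + w⁻¹ - 1) * expParam v)) := by
  have h : -(2 * Real.pi * v) * 2 - ((conj u)⁻¹ + w⁻¹ - 1) * expParam v =
      (-(2 * Real.pi * v) * 1 - ((conj u)⁻¹ - 1 / 2) * expParam v) +
      (-(2 * Real.pi * v) * 1 - (w⁻¹ - 1 / 2) * expParam v : ℂ) := by ring
  rw [h, Complex.exp_add]
  simp only [kernelSpectrum, map_mul, map_pow, map_inv₀, Complex.conj_conj, Complex.conj_ofReal,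
    ← Complex.exp_conj, map_sub, map_neg, map_div₀, map_one, map_ofNat]
  ring

theorem re_inv_conj_add_inv_sub_one_pos {u w : ℂ} (hu : u ∈ disk) (hw : w ∈ disk) :
    0 < ((conj u)⁻¹ + w⁻¹ - 1).re := by
  have h1 := half_lt_re_inv hu
  have h2 := half_lt_re_inv hw
  rw [Complex.sub_re, Complex.add_re, ← map_inv₀, Complex.conj_re, Complex.one_re]
  linarith

theorem integrable_kernelSpectrum_mul_conj {u w : ℂ} (hu : u ∈ disk) (hw : w ∈ disk) :
    Integrable fun v => kernelSpectrum u v * conj (kernelSpectrum w v) := by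
  simp only [kernelSpectrum_mul_conj]
  exact ((integrable_exp_expParam (by norm_num)
    (re_inv_conj_add_inv_sub_one_pos hu hw)).const_mul _).const_mul _

theorem integral_kernelSpectrum_mul_conj {u w : ℂ} (hu : u ∈ disk) (hw : w ∈ disk) :
    ∫ v, kernelSpectrum u v * conj (kernelSpectrum w v) =
      2 * (Real.pi * bergmanKernel u w) := by
  have hr := re_inv_conj_add_inv_sub_one_pos hu hw
  simp only [kernelSpectrum_mul_conj]
  rw [integral_const_mul, integral_const_mul,
    integral_exp_expParam (by norm_num) hr]
  have hu0 : conj u ≠ 0 := (map_ne_zero _).mpr (ne_zero_of_mem_disk hu)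
  have hw0 := ne_zero_of_mem_disk hw
  have hG : Complex.Gamma 2 = 1 := by simp
  have e : (conj u)⁻¹ + w⁻¹ - 1 = (w + conj u - w * conj u) / (conj u * w) := by field_simp
  have h0 : w + conj u - w * conj u ≠ 0 := by
    intro h
    rw [e, h] at hr
    simp at hr
  rw [hG, e, bergmanKernel, Complex.cpow_ofNat]
  field_simp

theorem memLp_kernelSpectrum {w : ℂ} (hw : w ∈ disk) : MemLp (kernelSpectrum w) 2 volume := by
  rw [memLp_two_iff_integrable_sq_norm (continuous_kernelSpectrum w).aestronglyMeasurable]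
  refine (integrable_kernelSpectrum_mul_conj hw hw).norm.congr (ae_of_all _ fun v => ?_)
  beta_reduce
  rw [norm_mul, RCLike.norm_conj, sq]

/-- The weight `t^z e^{-t/2}` of the Mellin transform, in the variable `v` with
`t = e^{-2πv}`. -/
noncomputable def mellinWeight (z : ℂ) (v : ℝ) : ℂ :=
  Complex.exp (-(2 * Real.pi * v) * z - 1 / 2 * expParam v)

theorem continuous_mellinWeight (z : ℂ) : Continuous (mellinWeight z) := by
  have := continuous_expParam
  unfold mellinWeight; fun_prop

theorem norm_mellinWeight (z : ℂ) (v : ℝ) :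
    ‖mellinWeight z v‖ = Real.exp (-(2 * Real.pi * v) * z.re - 1 / 2 * expParam v) := by
  rw [mellinWeight, Complex.norm_exp]
  simp

theorem memLp_mellinWeight {z : ℂ} (hz : 0 < z.re) : MemLp (mellinWeight z) 2 volume := by
  rw [memLp_two_iff_integrable_sq_norm (continuous_mellinWeight z).aestronglyMeasurable]
  have h := (integrable_exp_expParam (a := (2 * z.re : ℝ)) (r := 1)
    (by rw [Complex.ofReal_re]; positivity) (by simp)).norm
  refine h.congr (ae_of_all _ fun v => ?_)
  beta_reduce
  rw [norm_mellinWeight, Complex.norm_exp, ← Real.exp_nat_mul]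
  congr 1
  simp
  ring

theorem integral_mellinWeight_mul_kernelSpectrum {w z : ℂ} (hw : w ∈ disk) (hz : 0 < z.re) :
    ∫ v, mellinWeight z v * kernelSpectrum w v = Complex.Gamma (z + 1) * conj w ^ (z - 1) := by
  have hw0 : conj w ≠ 0 := (map_ne_zero _).mpr (ne_zero_of_mem_disk hw)
  have h1 : ∀ v, mellinWeight z v * kernelSpectrum w v = (conj w)⁻¹ ^ 2 * ((2 * Real.pi) *
      Complex.exp (-(2 * Real.pi * v) * (z + 1) - (conj w)⁻¹ * expParam v)) := fun v => by
    have h : -(2 * Real.pi * v) * (z + 1) - (conj w)⁻¹ * expParam v =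
      (-(2 * Real.pi * v) * z - 1 / 2 * expParam v) +
      (-(2 * Real.pi * v) * 1 - ((conj w)⁻¹ - 1 / 2) * expParam v : ℂ) := by ring
    rw [h, Complex.exp_add, mellinWeight, kernelSpectrum]
    ring
  have hr : 0 < ((conj w)⁻¹).re := by
    rw [← map_inv₀, Complex.conj_re]; linarith [half_lt_re_inv hw]
  simp only [h1]
  rw [integral_const_mul, integral_const_mul,
    integral_exp_expParam (by rw [Complex.add_re, Complex.one_re]; linarith) hr, one_div, inv_inv,
    show z + 1 = z - 1 + 2 by ring, Complex.cpow_add _ _ hw0, Complex.cpow_ofNat]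
  field_simp

/-- The holomorphic power function `ζ ^ (conj z - 1)`, whose conjugate is the kernel of the
Mellin--Bergman transform. -/
noncomputable def mellinPower (z ζ : ℂ) : ℂ := ζ ^ (conj z - 1)

theorem conj_mellinPower (z : ℂ) {ζ : ℂ} (hζ : ζ ∈ disk) :
    conj (mellinPower z ζ) = conj ζ ^ (z - 1) := by
  have harg : ζ.arg ≠ Real.pi := by
    intro h
    have := (Complex.arg_eq_pi_iff.mp h).1
    linarith [re_pos_of_mem_disk hζ]
  have h : conj z - 1 = conj (z - 1) := by rw [map_sub, map_one]
  rw [mellinPower, h, Complex.cpow_conj _ _ harg, Complex.conj_conj]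

theorem integrableOn_norm_rpow_disk {x : ℝ} (hx : 0 < x) :
    IntegrableOn (fun ζ : ℂ => ‖ζ‖ ^ (2 * x - 2)) disk := by
  have h1 : Integrable (fun ζ : ℂ =>
      Set.indicator (Set.Ioo 0 2) (fun y : ℝ => y ^ (2 * x - 2)) ‖ζ‖) := by
    rw [integrable_fun_norm_addHaar (volume : Measure ℂ)]
    have : ∀ y : ℝ, y ^ (Module.finrank ℝ ℂ - 1) •
        Set.indicator (Set.Ioo 0 2) (fun y : ℝ => y ^ (2 * x - 2)) y =
        Set.indicator (Set.Ioo 0 2) (fun y : ℝ => y ^ (2 * x - 1)) y := fun y => by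
      by_cases hy : y ∈ Set.Ioo (0 : ℝ) 2
      · simp only [Complex.finrank_real_complex, Set.indicator_of_mem hy]
        rw [show 2 * x - 1 = 1 + (2 * x - 2) by ring, Real.rpow_add hy.1]
        simp
      · simp [Set.indicator_of_notMem hy]
    simp only [this]
    refine Integrable.integrableOn ?_
    rw [integrable_indicator_iff measurableSet_Ioo]
    exact (intervalIntegral.integrableOn_Ioo_rpow_iff (by norm_num)).mpr (by linarith)
  refine h1.integrableOn.congr ?_
  refine (ae_restrict_iff' measurableSet_disk).mpr (ae_of_all _ fun ζ hζ => ?_)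
  refine Set.indicator_of_mem (s := Set.Ioo (0 : ℝ) 2)
    ⟨norm_pos_iff.mpr (ne_zero_of_mem_disk hζ), ?_⟩ _
  have h2 : ‖ζ - 1‖ < 1 := by simpa [disk, dist_eq_norm] using hζ
  have h3 := norm_sub_norm_le ζ 1
  rw [norm_one] at h3
  linarith

theorem isBergman_mellinPower {z : ℂ} (hz : 0 < z.re) : IsBergman (mellinPower z) := by
  have hd : DifferentiableOn ℂ (mellinPower z) disk := by
    intro ζ hζ
    refine DifferentiableAt.differentiableWithinAt ?_
    exact differentiableAt_id.cpow_const (Or.inl (re_pos_of_mem_disk hζ))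
  refine ⟨hd, ?_⟩
  have hm := hd.continuousOn.aestronglyMeasurable measurableSet_disk (μ := volume)
  rw [memLp_two_iff_integrable_sq_norm hm]
  refine ((integrableOn_norm_rpow_disk hz).mul_const
    (Real.exp (Real.pi * |z.im|) ^ 2)).mono' (by fun_prop) ?_
  refine (ae_restrict_iff' measurableSet_disk).mpr (ae_of_all _ fun ζ hζ => ?_)
  have h0 := ne_zero_of_mem_disk hζ
  rw [Real.norm_of_nonneg (by positivity), mellinPower, Complex.norm_cpow_of_ne_zero h0, div_pow,
    div_eq_mul_inv, ← Real.rpow_mul_natCast (norm_nonneg _), ← inv_pow, ← Real.exp_neg]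
  have e1 : (conj z - 1).re * (2 : ℕ) = 2 * z.re - 2 := by simp; ring
  have e2 : (conj z - 1).im = -z.im := by simp
  rw [e1, e2]
  gcongr
  calc -(ζ.arg * -z.im) ≤ |ζ.arg * z.im| := by rw [mul_neg, neg_neg]; exact le_abs_self _
    _ = |ζ.arg| * |z.im| := abs_mul _ _
    _ ≤ _ := by gcongr; exact Complex.abs_arg_le_pi ζ

theorem mellinBergman_eq_inner {f : ℂ → ℂ} (hf : IsBergman f) {z : ℂ} (hz : 0 < z.re) :
    mellinBergman f z =
      1 / Real.pi * inner ℂ ((isBergman_mellinPower hz).2.toLp _) (hf.2.toLp f) := by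
  rw [inner_toLp_toLp, mellinBergman]
  congr 1
  refine setIntegral_congr_fun measurableSet_disk fun ζ hζ => ?_
  rw [conj_mellinPower z hζ]

theorem inner_mellinPower_kernelLp (w : disk) {z : ℂ} (hz : 0 < z.re) :
    inner ℂ ((isBergman_mellinPower hz).2.toLp _) (kernelLp w) =
      Real.pi * conj (w : ℂ) ^ (z - 1) := by
  rw [← inner_conj_symm, inner_kernelLp (isBergman_mellinPower hz), map_mul,
    Complex.conj_ofReal, conj_mellinPower z w.2]

/-- The Hilbert space `L²(ℝ, dv)` that contains the spectra of the Bergman functions. -/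
abbrev L2Line : Type := Lp ℂ 2 (volume : Measure ℝ)

/-- The Bergman space is embedded in `L²(ℝ)`, isometrically up to the factor `2`, in such a way
that `Γ(z + 1) M_Δ f (z)` becomes a Mellin transform. Both assertions hold on kernels by
Euler's integral and extend by density. -/
theorem exists_spectralMap : ∃ J : L2Disk →L[ℂ] L2Line,
    (∀ f g (hf : IsBergman f) (hg : IsBergman g),
      inner ℂ (J (hf.2.toLp f)) (J (hg.2.toLp g)) =
        2 * inner ℂ (hf.2.toLp f) (hg.2.toLp g)) ∧
    ∀ f (hf : IsBergman f) (z : ℂ), 0 < z.re →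
      Complex.Gamma (z + 1) * mellinBergman f z =
        ∫ v, mellinWeight z v * J (hf.2.toLp f) v := by
  obtain ⟨J, hJk, hJ⟩ := exists_clm_of_gram kernelLp
    (fun w : disk => (memLp_kernelSpectrum w.2).toLp _) (c := 2) (by norm_num) (by
      intro u w
      rw [show kernelLp w = (isBergman_bergmanKernel w.2).2.toLp _ from rfl,
        inner_kernelLp (isBergman_bergmanKernel w.2), L2.inner_def, Complex.ofReal_ofNat,
        ← integral_kernelSpectrum_mul_conj w.2 u.2]
      refine integral_congr_ae ?_
      filter_upwards [(memLp_kernelSpectrum u.2).coeFn_toLp,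
        (memLp_kernelSpectrum w.2).coeFn_toLp] with v h1 h2
      rw [h1, h2, RCLike.inner_apply])
  refine ⟨J, fun f g hf hg => ?_, fun f hf z hz => ?_⟩
  · have := hJ _ hf.toLp_mem_kernelSpan _ hg.toLp_mem_kernelSpan
    rwa [Complex.ofReal_ofNat] at this
  · have hm : MemLp (fun v => conj (mellinWeight z v)) 2 volume := (memLp_mellinWeight hz).star
    have hint : ∀ x : L2Line, ∫ v, mellinWeight z v * x v = inner ℂ (hm.toLp _) x := by
      intro x
      rw [L2.inner_def]
      refine integral_congr_ae ?_
      filter_upwards [hm.coeFn_toLp] with v h1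
      rw [h1, RCLike.inner_apply, Complex.conj_conj, mul_comm]
    rw [hint, mellinBergman_eq_inner hf hz]
    -- Both sides are continuous linear functionals that agree on the kernels.
    set L₁ : L2Disk →L[ℂ] ℂ := (Complex.Gamma (z + 1) * (1 / Real.pi)) •
      innerSL ℂ ((isBergman_mellinPower hz).2.toLp (mellinPower z)) with hL₁
    set L₂ : L2Disk →L[ℂ] ℂ := (innerSL ℂ (hm.toLp _)).comp J with hL₂
    have hker : Submodule.span ℂ (Set.range kernelLp) ≤ (L₁ - L₂).ker := by
      rw [Submodule.span_le]
      rintro _ ⟨w, rfl⟩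
      change (L₁ - L₂) (kernelLp w) = 0
      rw [sub_apply, sub_eq_zero, hL₁, hL₂, smul_apply,
        ContinuousLinearMap.comp_apply, innerSL_apply_apply, innerSL_apply_apply, hJk,
        inner_mellinPower_kernelLp w hz, ← hint]
      have : ∫ v, mellinWeight z v * (memLp_kernelSpectrum w.2).toLp _ v =
          ∫ v, mellinWeight z v * kernelSpectrum w v := by
        refine integral_congr_ae ?_
        filter_upwards [(memLp_kernelSpectrum w.2).coeFn_toLp] with v h1
        rw [h1]
      rw [this, integral_mellinWeight_mul_kernelSpectrum w.2 hz, smul_eq_mul]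
      have hpi : (Real.pi : ℂ) ≠ 0 := by exact_mod_cast Real.pi_ne_zero
      field_simp
    have hmem : hf.2.toLp f ∈ (L₁ - L₂).ker :=
      (Submodule.topologicalClosure_minimal _ hker (ContinuousLinearMap.isClosed_ker _))
        hf.toLp_mem_kernelSpan
    have h := sub_eq_zero.mp (show L₁ (hf.2.toLp f) - L₂ (hf.2.toLp f) = 0 from hmem)
    rw [← mul_assoc]
    exact h

/-! ### Boundary values on vertical lines -/

/-- The weight on a vertical line of the closed half-plane is bounded, locally uniformly in the
abscissa: with `s = -2πv` it is `e^{xs - e^s / 2}`, and `e^s ≥ s² / 2` for `s ≥ 0`. -/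
theorem norm_mellinWeight_le {x : ℝ} (hx : 0 ≤ x) (v : ℝ) :
    ‖mellinWeight x v‖ ≤ Real.exp (x ^ 2) := by
  rw [norm_mellinWeight, Real.exp_le_exp, Complex.ofReal_re, expParam]
  set s := -(2 * Real.pi * v)
  rcases le_total 0 s with hs | hs
  · have := Real.quadratic_le_exp_of_nonneg hs
    nlinarith [sq_nonneg (s / 2 - x)]
  · nlinarith [Real.exp_pos s, mul_nonneg hx (neg_nonneg.mpr hs), sq_nonneg x]

/-- The function `2^{-x} t^x e^{-t/2} ψ`, with `t = e^{-2πv}`, whose Fourier transform is, up to a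
unimodular factor, the restriction of the weighted transform to the line `Re z = x`. -/
noncomputable def lineSpectrum (x : ℝ) (ψ : L2Line) (v : ℝ) : ℂ :=
  ((2 : ℝ) ^ (-x) : ℝ) * mellinWeight x v * ψ v

theorem aestronglyMeasurable_lineSpectrum (x : ℝ) (ψ : L2Line) :
    AEStronglyMeasurable (lineSpectrum x ψ) volume :=
  (continuous_const.mul (continuous_mellinWeight x)).aestronglyMeasurable.mul
    (Lp.aestronglyMeasurable ψ)

theorem norm_lineSpectrum_le {x : ℝ} (hx : 0 ≤ x) (ψ : L2Line) (v : ℝ) :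
    ‖lineSpectrum x ψ v‖ ≤ Real.exp (x ^ 2) * ‖ψ v‖ := by
  rw [lineSpectrum, norm_mul, norm_mul, Complex.norm_real, Real.norm_of_nonneg (by positivity)]
  have h1 : (2 : ℝ) ^ (-x) ≤ 1 := Real.rpow_le_one_of_one_le_of_nonpos (by norm_num) (by linarith)
  gcongr
  calc _ ≤ 1 * Real.exp (x ^ 2) := by gcongr; exact norm_mellinWeight_le hx v
    _ = _ := one_mul _

theorem memLp_lineSpectrum {x : ℝ} (hx : 0 ≤ x) (ψ : L2Line) :
    MemLp (lineSpectrum x ψ) 2 volume :=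
  (Lp.memLp ψ).of_le_mul (aestronglyMeasurable_lineSpectrum x ψ)
    (ae_of_all _ (norm_lineSpectrum_le hx ψ))

theorem integrable_lineSpectrum {x : ℝ} (hx : 0 < x) (ψ : L2Line) :
    Integrable (lineSpectrum x ψ) :=
  MemLp.integrable_mul (p := 2) (q := 2)
    ((memLp_mellinWeight (z := x) (by simpa using hx)).const_mul _) (Lp.memLp ψ)

theorem tendsto_eLpNorm_lineSpectrum_sub (ψ : L2Line) :
    Tendsto (fun x : ℝ => eLpNorm (lineSpectrum x ψ - lineSpectrum 0 ψ) 2 volume)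
      (𝓝[>] 0) (𝓝 0) := by
  have h2 : (fun x : ℝ => eLpNorm (lineSpectrum x ψ - lineSpectrum 0 ψ) 2 volume) =
      fun x => (∫⁻ v, ‖lineSpectrum x ψ v - lineSpectrum 0 ψ v‖ₑ ^ (2 : ℝ)) ^ (1 / 2 : ℝ) := by
    funext x
    rw [eLpNorm_eq_lintegral_rpow_enorm_toReal two_ne_zero ENNReal.ofNat_ne_top]
    simp
  rw [h2]
  have key : Tendsto (fun x : ℝ =>
      ∫⁻ v, ‖lineSpectrum x ψ v - lineSpectrum 0 ψ v‖ₑ ^ (2 : ℝ)) (𝓝[>] 0) (𝓝 0) := by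
    have h0 : (0 : ℝ≥0∞) = ∫⁻ _ : ℝ, 0 := by simp
    rw [h0]
    refine tendsto_lintegral_filter_of_dominated_convergence'
      (fun v => (ENNReal.ofReal (2 * Real.exp 1) * ‖ψ v‖ₑ) ^ (2 : ℝ)) ?_ ?_ ?_ ?_
    · exact Eventually.of_forall fun x => (((aestronglyMeasurable_lineSpectrum x ψ).sub
        (aestronglyMeasurable_lineSpectrum 0 ψ)).enorm.pow_const _)
    · filter_upwards [Ioo_mem_nhdsGT (zero_lt_one' ℝ)] with x hx
      refine ae_of_all _ fun v => ?_
      refine ENNReal.rpow_le_rpow ?_ (by norm_num)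
      rw [← ofReal_norm, ← ofReal_norm, ← ENNReal.ofReal_mul (by positivity)]
      refine ENNReal.ofReal_le_ofReal ?_
      refine (norm_sub_le _ _).trans ?_
      have e1 := norm_lineSpectrum_le hx.1.le ψ v
      have e2 := norm_lineSpectrum_le le_rfl ψ v
      have e3 : Real.exp (x ^ 2) ≤ Real.exp 1 :=
        Real.exp_le_exp.mpr (pow_le_one₀ hx.1.le hx.2.le)
      have e4 : Real.exp ((0 : ℝ) ^ 2) ≤ Real.exp 1 := Real.exp_le_exp.mpr (by norm_num)
      nlinarith [norm_nonneg (ψ v), mul_le_mul_of_nonneg_right e3 (norm_nonneg (ψ v)),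
        mul_le_mul_of_nonneg_right e4 (norm_nonneg (ψ v))]
    · simp_rw [ENNReal.mul_rpow_of_nonneg _ _ (zero_le_two (α := ℝ))]
      have hfin : ENNReal.ofReal (2 * Real.exp 1) ^ (2 : ℝ) ≠ ∞ :=
        ENNReal.rpow_ne_top_of_nonneg zero_le_two ENNReal.ofReal_ne_top
      rw [lintegral_const_mul' _ _ hfin]
      refine ENNReal.mul_ne_top hfin ?_
      have h3 := (Lp.memLp ψ).eLpNorm_lt_top
      rw [eLpNorm_lt_top_iff_lintegral_rpow_enorm_lt_top two_ne_zero ENNReal.ofNat_ne_top] at h3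
      simpa using h3.ne
    · refine ae_of_all _ fun v => ?_
      have hc : Continuous fun x : ℝ => lineSpectrum x ψ v := by
        unfold lineSpectrum mellinWeight
        have : Continuous fun x : ℝ => (2 : ℝ) ^ (-x) :=
          continuous_const.rpow continuous_neg fun _ => Or.inl (by norm_num)
        fun_prop
      have h4 : Tendsto (fun x : ℝ => lineSpectrum x ψ v - lineSpectrum 0 ψ v) (𝓝[>] 0) (𝓝 0) := by
        have := ((hc.tendsto 0).sub_const (lineSpectrum 0 ψ v)).mono_left
          (nhdsWithin_le_nhds (s := Set.Ioi 0))
        simpa using this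
      have h5 := ((ENNReal.continuous_rpow_const (y := 2)).tendsto _).comp h4.enorm
      simpa [Function.comp_def] using h5
  have h3 := ((ENNReal.continuous_rpow_const (y := 1 / 2)).tendsto _).comp key
  simpa [Function.comp_def] using h3

/-- The unimodular factor `2^{-iy}`. -/
noncomputable def phase (y : ℝ) : ℂ := (2 : ℂ) ^ (-(y * Complex.I))

theorem norm_phase (y : ℝ) : ‖phase y‖ = 1 := by
  have h := Complex.norm_cpow_eq_rpow_re_of_pos (zero_lt_two' ℝ) (-(y * Complex.I))
  rw [phase]
  simpa using h

theorem continuous_phase : Continuous phase := by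
  unfold phase
  exact Continuous.const_cpow (by fun_prop) (Or.inl two_ne_zero)

/-- The restriction of the weighted transform to the line `Re z = x`, including the boundary line
`x = 0`, in terms of the `L²` Fourier transform. -/
noncomputable def verticalTrace (x : ℝ) (hx : 0 ≤ x) (ψ : L2Line) (y : ℝ) : ℂ :=
  phase y * (𝓕 ((memLp_lineSpectrum hx ψ).toLp _) : L2Line) y

theorem measurable_verticalTrace (x : ℝ) (hx : 0 ≤ x) (ψ : L2Line) :
    Measurable (verticalTrace x hx ψ) :=
  continuous_phase.measurable.mul (Lp.stronglyMeasurable _).measurable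

theorem norm_verticalTrace (x : ℝ) (hx : 0 ≤ x) (ψ : L2Line) (y : ℝ) :
    ‖verticalTrace x hx ψ y‖ = ‖(𝓕 ((memLp_lineSpectrum hx ψ).toLp _) : L2Line) y‖ := by
  rw [verticalTrace, norm_mul, norm_phase, one_mul]

theorem memLp_verticalTrace (x : ℝ) (hx : 0 ≤ x) (ψ : L2Line) :
    MemLp (verticalTrace x hx ψ) 2 volume :=
  (Lp.memLp (𝓕 ((memLp_lineSpectrum hx ψ).toLp _) : L2Line)).of_le
    (measurable_verticalTrace x hx ψ).aestronglyMeasurable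
    (ae_of_all _ fun y => (norm_verticalTrace x hx ψ y).le)

theorem eLpNorm_verticalTrace_sub {x x' : ℝ} (hx : 0 ≤ x) (hx' : 0 ≤ x') (ψ : L2Line) :
    eLpNorm (fun y => verticalTrace x hx ψ y - verticalTrace x' hx' ψ y) 2 volume =
      eLpNorm (lineSpectrum x ψ - lineSpectrum x' ψ) 2 volume := by
  set A := (memLp_lineSpectrum hx ψ).toLp _ with hA
  set B := (memLp_lineSpectrum hx' ψ).toLp _ with hB
  have h1 : eLpNorm (fun y => verticalTrace x hx ψ y - verticalTrace x' hx' ψ y) 2 volume =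
      eLpNorm (𝓕 (A - B) : L2Line) 2 volume := by
    have hsub : (𝓕 (A - B) : L2Line) = 𝓕 A - 𝓕 B :=
      (Lp.fourierTransformₗᵢ ℝ ℂ).map_sub A B
    refine eLpNorm_congr_norm_ae ?_
    rw [hsub]
    filter_upwards [Lp.coeFn_sub (𝓕 A : L2Line) (𝓕 B)] with y hy
    rw [hy, verticalTrace, verticalTrace, ← mul_sub, norm_mul, norm_phase, one_mul, Pi.sub_apply]
  have h2 : eLpNorm (𝓕 (A - B) : L2Line) 2 volume = eLpNorm (A - B : L2Line) 2 volume := by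
    have := Lp.norm_fourier_eq (A - B)
    rw [Lp.norm_def, Lp.norm_def] at this
    exact (ENNReal.toReal_eq_toReal_iff' (Lp.eLpNorm_ne_top _) (Lp.eLpNorm_ne_top _)).mp this
  rw [h1, h2, hA, hB, ← MemLp.toLp_sub]
  exact eLpNorm_congr_ae (MemLp.coeFn_toLp _)

theorem integral_verticalTrace_mul_conj {x : ℝ} (hx : 0 ≤ x) (ψ χ : L2Line) :
    ∫ y, verticalTrace x hx ψ y * conj (verticalTrace x hx χ y) =
      ∫ v, lineSpectrum x ψ v * conj (lineSpectrum x χ v) := by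
  have h := Lp.inner_fourier_eq ((memLp_lineSpectrum hx χ).toLp _)
    ((memLp_lineSpectrum hx ψ).toLp _)
  rw [L2.inner_def, L2.inner_def] at h
  refine Eq.trans (integral_congr_ae (ae_of_all _ fun y => ?_)) (h.trans (integral_congr_ae ?_))
  · have hp : phase y * conj (phase y) = 1 := by
      rw [Complex.mul_conj, Complex.normSq_eq_norm_sq, norm_phase]; simp
    simp only [verticalTrace, map_mul, RCLike.inner_apply]
    linear_combination (𝓕 ((memLp_lineSpectrum hx ψ).toLp _) : L2Line) y *
      conj ((𝓕 ((memLp_lineSpectrum hx χ).toLp _) : L2Line) y) * hp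
  · filter_upwards [(memLp_lineSpectrum hx ψ).coeFn_toLp,
      (memLp_lineSpectrum hx χ).coeFn_toLp] with v h1 h2
    rw [h1, h2, RCLike.inner_apply]

/-- `ψ` is the spectrum of `f`: its Mellin transform with weight `e^{-t/2}` is
`Γ(z + 1) M_Δ f (z)` on the open right half-plane. -/
def IsSpectrum (f : ℂ → ℂ) (ψ : L2Line) : Prop :=
  ∀ z : ℂ, 0 < z.re → Complex.Gamma (z + 1) * mellinBergman f z = ∫ v, mellinWeight z v * ψ v

theorem IsSpectrum.weightedTransform_eq {f : ℂ → ℂ} {ψ : L2Line} (h : IsSpectrum f ψ) {z : ℂ}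
    (hz : 0 < z.re) :
    weightedTransform f z = (2 : ℂ) ^ (-z) * ∫ v, mellinWeight z v * ψ v := by
  rw [← h z hz, weightedTransform, Complex.cpow_neg]
  ring

theorem IsSpectrum.weightedTransform_eq_fourier {f : ℂ → ℂ} {ψ : L2Line} (h : IsSpectrum f ψ)
    {x : ℝ} (hx : 0 < x) (y : ℝ) :
    weightedTransform f ⟨x, y⟩ = phase y * 𝓕 (lineSpectrum x ψ) y := by
  rw [h.weightedTransform_eq (z := ⟨x, y⟩) hx, Real.fourier_real_eq_integral_exp_smul]
  have hz : (⟨x, y⟩ : ℂ) = x + y * Complex.I := by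
    apply Complex.ext <;> simp
  have e : (2 : ℂ) ^ (-(⟨x, y⟩ : ℂ)) = phase y * ((2 : ℝ) ^ (-x) : ℝ) := by
    rw [phase, hz, neg_add, Complex.cpow_add _ _ two_ne_zero, Complex.ofReal_cpow (by norm_num)]
    push_cast
    ring
  rw [e, mul_assoc, ← integral_const_mul]
  congr 1
  refine integral_congr_ae (ae_of_all _ fun v => ?_)
  have e2 : mellinWeight ⟨x, y⟩ v =
      Complex.exp (((-2 * Real.pi * v * y : ℝ) : ℂ) * Complex.I) * mellinWeight x v := by
    rw [mellinWeight, mellinWeight, ← Complex.exp_add, hz]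
    congr 1
    push_cast
    ring
  simp only [e2, lineSpectrum, smul_eq_mul]
  ring

theorem IsSpectrum.weightedTransform_ae_eq {f : ℂ → ℂ} {ψ : L2Line} (h : IsSpectrum f ψ)
    {x : ℝ} (hx : 0 < x) :
    (fun y : ℝ => weightedTransform f ⟨x, y⟩) =ᵐ[volume] verticalTrace x hx.le ψ := by
  filter_upwards [coeFn_fourier_toLp (integrable_lineSpectrum hx ψ)
    (memLp_lineSpectrum hx.le ψ)] with y hy
  rw [h.weightedTransform_eq_fourier hx, verticalTrace, hy]

/-- `L²` convergence of the weighted transform to its boundary trace. -/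
theorem IsSpectrum.tendsto_boundary {f : ℂ → ℂ} {ψ : L2Line} (h : IsSpectrum f ψ) :
    Tendsto (fun x : ℝ => eLpNorm
      (fun y : ℝ => weightedTransform f ⟨x, y⟩ - verticalTrace 0 le_rfl ψ y) 2 volume)
      (𝓝[>] 0) (𝓝 0) := by
  refine (tendsto_eLpNorm_lineSpectrum_sub ψ).congr' ?_
  filter_upwards [self_mem_nhdsWithin] with x hx
  rw [← eLpNorm_verticalTrace_sub (le_of_lt hx) le_rfl]
  refine eLpNorm_congr_ae ?_
  filter_upwards [h.weightedTransform_ae_eq hx] with y hy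
  rw [hy]

theorem IsSpectrum.exists_isBoundaryExtension {f : ℂ → ℂ} {ψ : L2Line} (h : IsSpectrum f ψ) :
    ∃ F, IsBoundaryExtension (weightedTransform f) F := by
  classical
  let F : ClosedRHP → ℂ := fun z => if 0 < z.1.re then
    (2 : ℂ) ^ (-z.1) * ∫ v, mellinWeight z.1 v * ψ v else verticalTrace 0 le_rfl ψ z.1.im
  have hF0 : ∀ y : ℝ, F (ClosedRHP.mk' 0 le_rfl y) = verticalTrace 0 le_rfl ψ y := fun y =>
    if_neg (lt_irrefl _)
  refine ⟨F, ?_, ?_, ?_, ?_⟩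
  · refine Measurable.ite ?_ (Measurable.mul ?_ ?_) ?_
    · exact measurableSet_lt measurable_const (Complex.measurable_re.comp measurable_subtype_coe)
    · refine Continuous.measurable (Continuous.const_cpow (by fun_prop) (Or.inl two_ne_zero))
    · have hc : Continuous fun p : ℂ × ℝ => mellinWeight p.1 p.2 := by
        have := continuous_expParam
        unfold mellinWeight; fun_prop
      have : StronglyMeasurable fun p : ℂ × ℝ => mellinWeight p.1 p.2 * ψ p.2 :=
        hc.stronglyMeasurable.mul ((Lp.stronglyMeasurable ψ).comp_measurable measurable_snd)
      exact (this.integral_prod_right' (ν := volume)).measurable.comp measurable_subtype_coe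
    · exact (measurable_verticalTrace 0 le_rfl ψ).comp
        (Complex.measurable_im.comp measurable_subtype_coe)
  · intro z hz
    rw [h.weightedTransform_eq hz]
    exact if_pos hz
  · simp only [hF0]
    exact memLp_verticalTrace 0 le_rfl ψ
  · simp only [hF0]
    exact h.tendsto_boundary

/-- Boundary values are unique up to null sets. -/
theorem ae_eq_of_tendsto_eLpNorm {u : ℝ → ℝ → ℂ} {a b : ℝ → ℂ}
    (hu : ∀ x, 0 < x → AEStronglyMeasurable (u x) volume)
    (ha : AEStronglyMeasurable a volume) (hb : AEStronglyMeasurable b volume)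
    (hua : Tendsto (fun x => eLpNorm (fun y => u x y - a y) 2 volume) (𝓝[>] 0) (𝓝 0))
    (hub : Tendsto (fun x => eLpNorm (fun y => u x y - b y) 2 volume) (𝓝[>] 0) (𝓝 0)) :
    a =ᵐ[volume] b := by
  have h1 : eLpNorm (a - b) 2 volume ≤ 0 := by
    have hlim := hua.add hub
    rw [add_zero] at hlim
    refine ge_of_tendsto hlim ?_
    filter_upwards [self_mem_nhdsWithin] with x hx
    have e : a - b = (fun y => u x y - b y) - (fun y => u x y - a y) := by
      funext y; simp
    rw [e, add_comm]
    exact eLpNorm_sub_le ((hu x hx).sub hb) ((hu x hx).sub ha) (by norm_num)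
  have h2 := (eLpNorm_eq_zero_iff (ha.sub hb) two_ne_zero).mp (nonpos_iff_eq_zero.mp h1)
  filter_upwards [h2] with y hy
  exact sub_eq_zero.mp hy

theorem IsSpectrum.extension_ae_eq {f : ℂ → ℂ} {ψ : L2Line} (h : IsSpectrum f ψ)
    {F : ClosedRHP → ℂ} (hF : IsBoundaryExtension (weightedTransform f) F) {x : ℝ} (hx : 0 ≤ x) :
    (fun y => F (ClosedRHP.mk' x hx y)) =ᵐ[volume] verticalTrace x hx ψ := by
  rcases hx.eq_or_lt with rfl | hpos
  · refine ae_eq_of_tendsto_eLpNorm (u := fun x y => weightedTransform f ⟨x, y⟩)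
      (fun x hx => ?_) hF.memLp_boundary.aestronglyMeasurable
      (measurable_verticalTrace 0 le_rfl ψ).aestronglyMeasurable
      hF.tendsto_boundary h.tendsto_boundary
    exact (measurable_verticalTrace x (le_of_lt hx) ψ).aestronglyMeasurable.congr
      (h.weightedTransform_ae_eq hx).symm
  · filter_upwards [h.weightedTransform_ae_eq hpos] with y hy
    rw [hF.eq_interior _ hpos, ← hy]
    rfl

/-! ### The measure `ω` -/

/-- The Poisson weight `e^{-t} t^n / n!` at `t = e^{-2πv}`. -/
noncomputable def poissonWeight (n : ℕ) (v : ℝ) : ℝ :=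
  Real.exp (-expParam v) * (expParam v ^ n / n !)

theorem poissonWeight_nonneg (n : ℕ) (v : ℝ) : 0 ≤ poissonWeight n v := by
  have := (expParam_pos v).le
  unfold poissonWeight; positivity

theorem continuous_poissonWeight (n : ℕ) : Continuous (poissonWeight n) := by
  have := continuous_expParam
  unfold poissonWeight; fun_prop

theorem hasSum_poissonWeight (v : ℝ) : HasSum (fun n => poissonWeight n v) 1 := by
  have h : HasSum (fun n : ℕ => expParam v ^ n / n !) (Real.exp (expParam v)) := by
    rw [Real.exp_eq_exp_ℝ]; exact NormedSpace.expSeries_div_hasSum_exp _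
  have h2 := h.mul_left (Real.exp (-expParam v))
  rwa [← Real.exp_add, neg_add_cancel, Real.exp_zero] at h2

/-- The mass `2ⁿ / n!` that `ω` puts on the line `Re z = n / 2` turns the product of two spectra on
that line into the Poisson weight. -/
theorem lineSpectrum_mul_conj (n : ℕ) (ψ χ : L2Line) (v : ℝ) :
    ((2 : ℂ) ^ n / n !) *
      (lineSpectrum ((n : ℝ) / 2) ψ v * conj (lineSpectrum ((n : ℝ) / 2) χ v)) =
      poissonWeight n v * (ψ v * conj (χ v)) := by
  have hm : mellinWeight ((n : ℝ) / 2 : ℝ) v =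
      (Real.exp (-(2 * Real.pi * v) * (n / 2) - 1 / 2 * expParam v) : ℝ) := by
    rw [mellinWeight]; push_cast; rfl
  have e1 : Real.exp (-(2 * Real.pi * v) * (n / 2) - 1 / 2 * expParam v) *
      Real.exp (-(2 * Real.pi * v) * (n / 2) - 1 / 2 * expParam v) =
      Real.exp (-expParam v) * expParam v ^ n := by
    nth_rewrite 4 [expParam]
    rw [← Real.exp_add, ← Real.exp_nat_mul, ← Real.exp_add]
    congr 1; ring
  have e2 : (2 : ℝ) ^ n * ((2 : ℝ) ^ (-((n : ℝ) / 2)) * (2 : ℝ) ^ (-((n : ℝ) / 2))) = 1 := by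
    rw [← Real.rpow_add two_pos, ← Real.rpow_natCast, ← Real.rpow_add two_pos]
    ring_nf
    exact Real.rpow_zero 2
  have e3 : (2 : ℝ) ^ n / n ! * (((2 : ℝ) ^ (-((n : ℝ) / 2)) *
      Real.exp (-(2 * Real.pi * v) * (n / 2) - 1 / 2 * expParam v)) *
      ((2 : ℝ) ^ (-((n : ℝ) / 2)) *
      Real.exp (-(2 * Real.pi * v) * (n / 2) - 1 / 2 * expParam v))) = poissonWeight n v := by
    have e4 : poissonWeight n v =
        Real.exp (-(2 * Real.pi * v) * (n / 2) - 1 / 2 * expParam v) *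
          Real.exp (-(2 * Real.pi * v) * (n / 2) - 1 / 2 * expParam v) / n ! := by
      rw [e1, poissonWeight, mul_div_assoc]
    rw [e4]
    linear_combination (Real.exp (-(2 * Real.pi * v) * (n / 2) - 1 / 2 * expParam v) *
      Real.exp (-(2 * Real.pi * v) * (n / 2) - 1 / 2 * expParam v) / n !) * e2
  rw [← e3, lineSpectrum, lineSpectrum, hm]
  simp only [map_mul, Complex.conj_ofReal]
  push_cast
  ring

theorem enorm_sq_lineSpectrum (n : ℕ) (ψ : L2Line) (v : ℝ) :
    ((2 : ℝ≥0∞) ^ n / (n ! : ℝ≥0∞)) * ‖lineSpectrum ((n : ℝ) / 2) ψ v‖ₑ ^ 2 =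
      ENNReal.ofReal (poissonWeight n v) * ‖ψ v‖ₑ ^ 2 := by
  have h := congrArg (fun c : ℂ => ‖c‖ₑ) (lineSpectrum_mul_conj n ψ ψ v)
  simp only [enorm_mul, RCLike.enorm_conj, ← sq] at h
  have hn : ‖((2 : ℂ) ^ n / n !)‖ₑ = (2 : ℝ≥0∞) ^ n / (n ! : ℝ≥0∞) := by
    rw [← ofReal_norm, norm_div, norm_pow, Complex.norm_natCast, Complex.norm_ofNat,
      ENNReal.ofReal_div_of_pos (by positivity), ENNReal.ofReal_pow (by norm_num)]
    simp
  have hp : ‖(poissonWeight n v : ℂ)‖ₑ = ENNReal.ofReal (poissonWeight n v) := by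
    rw [← ofReal_norm, Complex.norm_real, Real.norm_of_nonneg (poissonWeight_nonneg n v)]
  rwa [hn, hp] at h

theorem lintegral_enorm_sq_eq_eLpNorm_sq {α : Type*} [MeasurableSpace α] {μ : Measure α}
    (g : α → ℂ) : ∫⁻ a, ‖g a‖ₑ ^ 2 ∂μ = eLpNorm g 2 μ ^ 2 := by
  have := eLpNorm_nnreal_pow_eq_lintegral (μ := μ) (f := g) (p := 2) two_ne_zero
  simp only [NNReal.coe_ofNat, ENNReal.rpow_ofNat] at this
  exact this.symm

theorem lintegral_enorm_sq_verticalTrace {x : ℝ} (hx : 0 ≤ x) (ψ : L2Line) :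
    ∫⁻ y, ‖verticalTrace x hx ψ y‖ₑ ^ 2 = ∫⁻ v, ‖lineSpectrum x ψ v‖ₑ ^ 2 := by
  set A := (memLp_lineSpectrum hx ψ).toLp _ with hA
  have h2 : eLpNorm (𝓕 A : L2Line) 2 volume = eLpNorm A 2 volume := by
    have := Lp.norm_fourier_eq A
    rw [Lp.norm_def, Lp.norm_def] at this
    exact (ENNReal.toReal_eq_toReal_iff' (Lp.eLpNorm_ne_top _) (Lp.eLpNorm_ne_top _)).mp this
  rw [lintegral_enorm_sq_eq_eLpNorm_sq, lintegral_enorm_sq_eq_eLpNorm_sq,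
    ← eLpNorm_congr_ae (memLp_lineSpectrum hx ψ).coeFn_toLp, ← hA, ← h2,
    eLpNorm_congr_norm_ae (ae_of_all _ (norm_verticalTrace x hx ψ))]

theorem continuous_mk' (x : ℝ) (hx : 0 ≤ x) : Continuous (ClosedRHP.mk' x hx) := by
  refine Continuous.subtype_mk ?_ _
  exact Complex.equivRealProdCLM.symm.continuous.comp (Continuous.prodMk_right x)

/-- Extended transforms are square integrable for `ω`. By Plancherel's theorem the line
`Re z = n / 2` contributes `|ψ|²` with the Poisson weight of index `n`, and these weights sum
to `1`. -/
theorem IsSpectrum.memLp_omega {f : ℂ → ℂ} {ψ : L2Line} (h : IsSpectrum f ψ)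
    {F : ClosedRHP → ℂ} (hF : IsBoundaryExtension (weightedTransform f) F) : MemLp F 2 omega := by
  refine ⟨hF.measurable.aestronglyMeasurable, ?_⟩
  have hsq : ∫⁻ z, ‖F z‖ₑ ^ 2 ∂omega = ∫⁻ v, ‖ψ v‖ₑ ^ 2 := by
    rw [omega, lintegral_sum_measure]
    have h1 : ∀ n : ℕ, ∫⁻ z, ‖F z‖ₑ ^ 2 ∂(((2 : ℝ≥0∞) ^ n / (n ! : ℝ≥0∞)) •
        (volume : Measure ℝ).map (ClosedRHP.mk' ((n : ℝ) / 2) (by positivity))) =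
        ∫⁻ v, ENNReal.ofReal (poissonWeight n v) * ‖ψ v‖ₑ ^ 2 := by
      intro n
      have hx : (0 : ℝ) ≤ (n : ℝ) / 2 := by positivity
      rw [lintegral_smul_measure, lintegral_map (hF.measurable.enorm.pow_const 2)
        (continuous_mk' _ _).measurable]
      have h2 : ∫⁻ y, ‖F (ClosedRHP.mk' ((n : ℝ) / 2) hx y)‖ₑ ^ 2 =
          ∫⁻ y, ‖verticalTrace ((n : ℝ) / 2) hx ψ y‖ₑ ^ 2 := by
        refine lintegral_congr_ae ?_
        filter_upwards [h.extension_ae_eq hF hx] with y hy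
        rw [hy]
      rw [h2, lintegral_enorm_sq_verticalTrace, smul_eq_mul, ← lintegral_const_mul'' _
        ((aestronglyMeasurable_lineSpectrum _ ψ).enorm.pow_const 2)]
      simp only [enorm_sq_lineSpectrum]
    simp only [h1]
    have hmeas : ∀ n, AEMeasurable
        (fun v => ENNReal.ofReal (poissonWeight n v) * ‖ψ v‖ₑ ^ 2) volume := fun n =>
      (continuous_poissonWeight n).measurable.ennreal_ofReal.aemeasurable.mul
        ((Lp.aestronglyMeasurable ψ).enorm.pow_const 2)
    rw [← lintegral_tsum hmeas]
    refine lintegral_congr fun v => ?_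
    rw [ENNReal.tsum_mul_right, ← ENNReal.ofReal_tsum_of_nonneg
      (fun n => poissonWeight_nonneg n v) (hasSum_poissonWeight v).summable,
      (hasSum_poissonWeight v).tsum_eq, ENNReal.ofReal_one, one_mul]
  rw [lintegral_enorm_sq_eq_eLpNorm_sq, lintegral_enorm_sq_eq_eLpNorm_sq] at hsq
  have h3 : eLpNorm F 2 omega ^ 2 < ∞ := hsq ▸ ENNReal.pow_lt_top (Lp.eLpNorm_lt_top ψ)
  exact (ENNReal.pow_lt_top_iff.mp h3).resolve_right two_ne_zero

/-- Parseval's identity for the measure `ω`, by summation over the lines `Re z = n / 2`. -/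
theorem IsSpectrum.integral_omega {f g : ℂ → ℂ} {ψ χ : L2Line} (hf : IsSpectrum f ψ)
    (hg : IsSpectrum g χ) {F G : ClosedRHP → ℂ}
    (hF : IsBoundaryExtension (weightedTransform f) F)
    (hG : IsBoundaryExtension (weightedTransform g) G) :
    ∫ z, F z * conj (G z) ∂omega = ∫ v, ψ v * conj (χ v) := by
  have hint : Integrable (fun z => F z * conj (G z)) omega :=
    MemLp.integrable_mul (p := 2) (q := 2) (hf.memLp_omega hF) (hg.memLp_omega hG).star
  have hs1 := hasSum_integral_measure (μ := fun n : ℕ => ((2 : ℝ≥0∞) ^ n / (n ! : ℝ≥0∞)) •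
      (volume : Measure ℝ).map (ClosedRHP.mk' ((n : ℝ) / 2) (by positivity))) hint
  have hterm : ∀ n : ℕ, ∫ z, F z * conj (G z) ∂(((2 : ℝ≥0∞) ^ n / (n ! : ℝ≥0∞)) •
      (volume : Measure ℝ).map (ClosedRHP.mk' ((n : ℝ) / 2) (by positivity))) =
      ∫ v, poissonWeight n v * (ψ v * conj (χ v)) := by
    intro n
    have hx : (0 : ℝ) ≤ (n : ℝ) / 2 := by positivity
    have hmeas : Measurable fun z => F z * conj (G z) :=
      hF.measurable.mul (Complex.continuous_conj.measurable.comp hG.measurable)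
    rw [integral_smul_measure, integral_map (continuous_mk' _ _).measurable.aemeasurable
      hmeas.aestronglyMeasurable]
    have h2 : ∫ y, F (ClosedRHP.mk' ((n : ℝ) / 2) hx y) *
        conj (G (ClosedRHP.mk' ((n : ℝ) / 2) hx y)) =
        ∫ y, verticalTrace ((n : ℝ) / 2) hx ψ y * conj (verticalTrace ((n : ℝ) / 2) hx χ y) := by
      refine integral_congr_ae ?_
      filter_upwards [hf.extension_ae_eq hF hx, hg.extension_ae_eq hG hx] with y h3 h4
      rw [h3, h4]
    rw [h2, integral_verticalTrace_mul_conj]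
    simp only [← lineSpectrum_mul_conj]
    rw [integral_const_mul, ENNReal.toReal_div, ENNReal.toReal_pow, ENNReal.toReal_ofNat,
      ENNReal.toReal_natCast, Complex.real_smul]
    push_cast
    rfl
  simp only [hterm] at hs1
  have hψχ : Integrable (fun v => ψ v * conj (χ v)) :=
    MemLp.integrable_mul (p := 2) (q := 2) (Lp.memLp ψ) (Lp.memLp χ).star
  have hs2 := hasSum_integral_of_dominated_convergence (μ := (volume : Measure ℝ))
    (F := fun (n : ℕ) v => (poissonWeight n v : ℂ) * (ψ v * conj (χ v)))
    (f := fun v => ψ v * conj (χ v))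
    (fun n v => poissonWeight n v * ‖ψ v * conj (χ v)‖)
    (fun n => (Complex.continuous_ofReal.comp
      (continuous_poissonWeight n)).aestronglyMeasurable.mul hψχ.aestronglyMeasurable)
    (fun n => ae_of_all _ fun v => by
      rw [norm_mul, Complex.norm_real, Real.norm_of_nonneg (poissonWeight_nonneg n v)])
    (ae_of_all _ fun v => (hasSum_poissonWeight v).summable.mul_right _)
    (by
      refine hψχ.norm.congr (ae_of_all _ fun v => ?_)
      beta_reduce
      rw [((hasSum_poissonWeight v).mul_right _).tsum_eq, one_mul])
    (ae_of_all _ fun v => by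
      have := (Complex.hasSum_ofReal.mpr (hasSum_poissonWeight v)).mul_right (ψ v * conj (χ v))
      rwa [Complex.ofReal_one, one_mul] at this)
  exact hs1.unique hs2

/-- Every Bergman function has a spectrum, isometrically up to the factor `2π`. -/
theorem exists_isSpectrum : ∃ Ψ : (ℂ → ℂ) → L2Line, (∀ f, IsBergman f → IsSpectrum f (Ψ f)) ∧
    ∀ f g, IsBergman f → IsBergman g →
      bergmanInner f g = 1 / (2 * (Real.pi : ℂ)) * ∫ v, Ψ f v * conj (Ψ g v) := by
  classical
  obtain ⟨J, hJ, hM⟩ := exists_spectralMap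
  refine ⟨fun f => if hf : IsBergman f then J (hf.2.toLp f) else 0, fun f hf z hz => ?_,
    fun f g hf hg => ?_⟩
  · simp only [dif_pos hf]
    exact hM f hf z hz
  · simp only [dif_pos hf, dif_pos hg]
    have h := hJ g f hg hf
    rw [inner_toLp_toLp, L2.inner_def] at h
    simp only [RCLike.inner_apply] at h
    rw [h, bergmanInner]
    have : (Real.pi : ℂ) ≠ 0 := by exact_mod_cast Real.pi_ne_zero
    field_simp

theorem preservesInner_omega : PreservesInner omega := by
  obtain ⟨Ψ, hΨ, hin⟩ := exists_isSpectrum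
  intro f g hf hg F G hF hG
  refine ⟨(hΨ f hf).memLp_omega hF, (hΨ g hg).memLp_omega hG, ?_⟩
  rw [(hΨ f hf).integral_omega (hΨ g hg) hF hG, hin f g hf hg]

theorem continuous_translate (c : ℝ) : Continuous (ClosedRHP.translate c) := by
  refine Continuous.subtype_mk ?_ _
  exact Complex.equivRealProdCLM.symm.continuous.comp
    ((Complex.continuous_re.comp continuous_subtype_val).prodMk
      ((Complex.continuous_im.comp continuous_subtype_val).add continuous_const))

theorem translationInvariant_omega : TranslationInvariant omega := by
  intro c
  have hc := (continuous_translate c).measurable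
  ext s hs
  rw [Measure.map_apply hc hs, omega, Measure.sum_apply _ (hc hs), Measure.sum_apply _ hs]
  refine tsum_congr fun n => ?_
  rw [Measure.smul_apply, Measure.smul_apply,
    Measure.map_apply (continuous_mk' _ _).measurable (hc hs),
    Measure.map_apply (continuous_mk' _ _).measurable hs]
  congr 1
  exact measure_preimage_add_right volume c (ClosedRHP.mk' ((n : ℝ) / 2) (by positivity) ⁻¹' s)

/-! ### Uniqueness of the measure -/

/-- The weighted transform of the Bergman kernel `K_w`, given by its formula on the whole closed
right half-plane. -/
noncomputable def kernelTransform (w : ℂ) (z : ClosedRHP) : ℂ :=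
  Complex.Gamma (z.1 + 1) / 2 ^ z.1 * conj w ^ (z.1 - 1)

theorem re_add_one_pos (z : ClosedRHP) : 0 < (z.1 + 1).re := by
  rw [Complex.add_re, Complex.one_re]; linarith [z.2]

theorem continuous_kernelTransform {w : ℂ} (hw : w ≠ 0) : Continuous (kernelTransform w) := by
  have hw' : conj w ≠ 0 := (map_ne_zero _).mpr hw
  have hG : Continuous fun z : ClosedRHP => Complex.Gamma (z.1 + 1) := by
    refine continuous_iff_continuousAt.mpr fun z => ?_
    have h1 : ContinuousAt Complex.Gamma (z.1 + 1) := by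
      refine (Complex.differentiableAt_Gamma _ fun m hm => ?_).continuousAt
      have := re_add_one_pos z
      rw [hm] at this
      simp at this
      linarith [m.cast_nonneg (α := ℝ)]
    exact ContinuousAt.comp (f := fun z : ClosedRHP => z.1 + 1) h1 (by fun_prop)
  refine (hG.div (Continuous.const_cpow (by fun_prop) (Or.inl two_ne_zero)) fun z => ?_).mul
    (Continuous.const_cpow (by fun_prop) (Or.inl hw'))
  rw [Complex.cpow_def_of_ne_zero two_ne_zero]
  exact Complex.exp_ne_zero _

theorem kernelTransform_ne_zero {w : ℂ} (hw : w ≠ 0) (z : ClosedRHP) :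
    kernelTransform w z ≠ 0 := by
  have hw' : conj w ≠ 0 := (map_ne_zero _).mpr hw
  refine mul_ne_zero (div_ne_zero (Complex.Gamma_ne_zero_of_re_pos (re_add_one_pos z)) ?_) ?_
  · rw [Complex.cpow_def_of_ne_zero two_ne_zero]; exact Complex.exp_ne_zero _
  · rw [Complex.cpow_def_of_ne_zero hw']; exact Complex.exp_ne_zero _

theorem mellinBergman_bergmanKernel {w : ℂ} (hw : w ∈ disk) {z : ℂ} (hz : 0 < z.re) :
    mellinBergman (bergmanKernel w) z = conj w ^ (z - 1) := by
  have h := inner_mellinPower_kernelLp ⟨w, hw⟩ hz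
  rw [kernelLp] at h
  rw [mellinBergman_eq_inner (isBergman_bergmanKernel hw) hz, h]
  have : (Real.pi : ℂ) ≠ 0 := by exact_mod_cast Real.pi_ne_zero
  field_simp

theorem kernelTransform_eq {w : ℂ} (hw : w ∈ disk) (z : ClosedRHP) (hz : 0 < z.1.re) :
    kernelTransform w z = weightedTransform (bergmanKernel w) z.1 := by
  rw [weightedTransform, mellinBergman_bergmanKernel hw hz, kernelTransform]

/-- The explicit formula extends to the boundary: the `L²` boundary values agree with the pointwise
ones almost everywhere. -/
theorem isBoundaryExtension_kernelTransform {w : ℂ} (hw : w ∈ disk) :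
    IsBoundaryExtension (weightedTransform (bergmanKernel w)) (kernelTransform w) := by
  obtain ⟨Ψ, hΨ, -⟩ := exists_isSpectrum
  have hb := isBergman_bergmanKernel hw
  obtain ⟨F, hF⟩ := (hΨ _ hb).exists_isBoundaryExtension
  have hc := continuous_kernelTransform (ne_zero_of_mem_disk hw)
  have hx : ∀ n : ℕ, (0 : ℝ) < 1 / ((n : ℝ) + 1) := fun n => by positivity
  have hlim : Tendsto (fun n : ℕ => 1 / ((n : ℝ) + 1)) atTop (𝓝[>] 0) :=
    tendsto_nhdsWithin_iff.mpr ⟨tendsto_one_div_add_atTop_nhds_zero_nat,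
      Eventually.of_forall hx⟩
  have hmk : ∀ y : ℝ, Continuous fun p : Set.Ici (0 : ℝ) => ClosedRHP.mk' p.1 p.2 y := fun y => by
    refine Continuous.subtype_mk ?_ _
    exact Complex.equivRealProdCLM.symm.continuous.comp
      (continuous_subtype_val.prodMk continuous_const)
  have hae : (fun y => F (ClosedRHP.mk' 0 le_rfl y)) =ᵐ[volume]
      fun y => kernelTransform w (ClosedRHP.mk' 0 le_rfl y) := by
    have hm := tendstoInMeasure_of_tendsto_eLpNorm (p := 2) (μ := (volume : Measure ℝ))
      (f := fun (n : ℕ) (y : ℝ) =>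
        kernelTransform w (ClosedRHP.mk' (1 / ((n : ℝ) + 1)) (hx n).le y))
      (g := fun y => F (ClosedRHP.mk' 0 le_rfl y)) (l := atTop) two_ne_zero
      (fun n => (hc.comp (continuous_mk' _ _)).aestronglyMeasurable)
      hF.memLp_boundary.aestronglyMeasurable (by
        refine (hF.tendsto_boundary.comp hlim).congr fun n => ?_
        refine eLpNorm_congr_ae (ae_of_all _ fun y => ?_)
        have := kernelTransform_eq hw (ClosedRHP.mk' (1 / ((n : ℝ) + 1)) (hx n).le y) (hx n)
        simp only [Pi.sub_apply]
        rw [this]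
        rfl)
    obtain ⟨ns, hns, hae⟩ := hm.exists_seq_tendsto_ae
    filter_upwards [hae] with y hy
    refine tendsto_nhds_unique hy ?_
    have h1 : Tendsto (fun n : ℕ => (⟨1 / ((n : ℝ) + 1), (hx n).le⟩ : Set.Ici (0 : ℝ))) atTop
        (𝓝 ⟨0, le_refl (0 : ℝ)⟩) := tendsto_subtype_rng.mpr tendsto_one_div_add_atTop_nhds_zero_nat
    exact (((hc.comp (hmk y)).tendsto _).comp h1).comp hns.tendsto_atTop
  refine ⟨hc.measurable, fun z hz => kernelTransform_eq hw z hz,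
    (memLp_congr_ae hae).mp hF.memLp_boundary, hF.tendsto_boundary.congr fun x => ?_⟩
  refine eLpNorm_congr_ae ?_
  filter_upwards [hae] with y hy
  rw [hy]

theorem PreservesInner.lintegral_kernelTransform {μ : Measure ClosedRHP} (hμ : PreservesInner μ)
    {w : ℂ} (hw : w ∈ disk) :
    ∫⁻ z, ‖kernelTransform w z‖ₑ ^ 2 ∂μ =
      ENNReal.ofReal (2 * Real.pi * (bergmanInner (bergmanKernel w) (bergmanKernel w)).re) := by
  have hb := isBergman_bergmanKernel hw
  have hext := isBoundaryExtension_kernelTransform hw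
  obtain ⟨hL, -, hin⟩ := hμ _ _ hb hb _ _ hext hext
  have hi : Integrable (fun z => ‖kernelTransform w z‖ ^ 2) μ := hL.integrable_norm_pow two_ne_zero
  have h1 : ∫ z, kernelTransform w z * conj (kernelTransform w z) ∂μ =
      ((∫ z, ‖kernelTransform w z‖ ^ 2 ∂μ : ℝ) : ℂ) := by
    rw [← integral_complex_ofReal]
    refine integral_congr_ae (ae_of_all _ fun z => ?_)
    beta_reduce
    rw [Complex.mul_conj, Complex.normSq_eq_norm_sq]
  have h2 : 2 * Real.pi * (bergmanInner (bergmanKernel w) (bergmanKernel w)).re =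
      ∫ z, ‖kernelTransform w z‖ ^ 2 ∂μ := by
    rw [hin, h1]
    have : (1 / (2 * (Real.pi : ℂ))) = ((1 / (2 * Real.pi) : ℝ) : ℂ) := by push_cast; rfl
    rw [this, ← Complex.ofReal_mul, Complex.ofReal_re]
    have := Real.pi_ne_zero
    field_simp
  rw [h2, ofReal_integral_eq_lintegral_ofReal hi (ae_of_all _ fun z => by positivity)]
  refine lintegral_congr fun z => ?_
  rw [ENNReal.ofReal_pow (norm_nonneg _), ofReal_norm]

theorem one_mem_disk : (1 : ℂ) ∈ disk := by simp [disk]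

theorem PreservesInner.isFiniteMeasureOnCompacts {μ : Measure ClosedRHP}
    (hμ : PreservesInner μ) : IsFiniteMeasureOnCompacts μ := by
  refine ⟨fun K hK => ?_⟩
  rcases K.eq_empty_or_nonempty with rfl | hne
  · simp
  have hc := continuous_kernelTransform (one_ne_zero (α := ℂ))
  obtain ⟨z₀, -, hz₀⟩ := hK.exists_isMinOn hne hc.norm.continuousOn
  have hfin : ∫⁻ z, ‖kernelTransform 1 z‖ₑ ^ 2 ∂μ ≠ ∞ := by
    rw [hμ.lintegral_kernelTransform one_mem_disk]; exact ENNReal.ofReal_ne_top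
  have h1 := meas_ge_le_lintegral_div (μ := μ) (f := fun z => ‖kernelTransform 1 z‖ₑ ^ 2)
    (hc.measurable.enorm.pow_const 2).aemeasurable (ε := ‖kernelTransform 1 z₀‖ₑ ^ 2)
    (by simpa using kernelTransform_ne_zero one_ne_zero z₀) (by simp)
  refine lt_of_le_of_lt (measure_mono fun z hz => ?_) (h1.trans_lt (ENNReal.div_lt_top hfin
    (by simpa using kernelTransform_ne_zero one_ne_zero z₀)))
  have h2 : ‖kernelTransform 1 z₀‖ ≤ ‖kernelTransform 1 z‖ := hz₀ hz
  change ‖kernelTransform 1 z₀‖ₑ ^ 2 ≤ ‖kernelTransform 1 z‖ₑ ^ 2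
  gcongr
  exact enorm_le_iff_norm_le.mpr h2

/-- The retraction `(x, y) ↦ max x 0 + i y` of the plane onto the closed right half-plane. -/
noncomputable def ofCoords (p : ℝ × ℝ) : ClosedRHP :=
  ClosedRHP.mk' (max p.1 0) (le_max_right _ _) p.2

theorem continuous_ofCoords : Continuous ofCoords := by
  refine Continuous.subtype_mk ?_ _
  exact Complex.equivRealProdCLM.symm.continuous.comp
    ((continuous_fst.max continuous_const).prodMk continuous_snd)

theorem measurable_re : Measurable fun z : ClosedRHP => z.1.re :=
  Complex.measurable_re.comp measurable_subtype_coe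

theorem measurable_im : Measurable fun z : ClosedRHP => z.1.im :=
  Complex.measurable_im.comp measurable_subtype_coe

theorem ofCoords_coords (z : ClosedRHP) : ofCoords (z.1.re, z.1.im) = z := by
  apply Subtype.ext
  apply Complex.ext
  · exact max_eq_left z.2
  · rfl

/-- The horizontal factor of a translation invariant measure: the mass above each set of abscissas
in a strip of height one. -/
noncomputable def horizontalPart (μ : Measure ClosedRHP) : Measure ℝ :=
  (μ.restrict {z | z.1.im ∈ Set.Ico (0 : ℝ) 1}).map fun z => z.1.re

theorem horizontalPart_apply (μ : Measure ClosedRHP) {A : Set ℝ} (hA : MeasurableSet A) :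
    horizontalPart μ A = μ {z | z.1.re ∈ A ∧ z.1.im ∈ Set.Ico (0 : ℝ) 1} := by
  rw [horizontalPart, Measure.map_apply measurable_re hA, Measure.restrict_apply (measurable_re hA)]
  rfl

theorem measure_bounded_rect_lt_top {μ : Measure ClosedRHP} [IsFiniteMeasureOnCompacts μ] (N : ℝ)
    {C : Set ℝ} (hC : IsCompact C) : μ {z | z.1.re ≤ N ∧ z.1.im ∈ C} < ∞ := by
  refine lt_of_le_of_lt (measure_mono ?_)
    (((isCompact_Icc (a := (0 : ℝ)) (b := N)).prod hC).image continuous_ofCoords).measure_lt_top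
  rintro z ⟨h1, h2⟩
  exact ⟨(z.1.re, z.1.im), ⟨⟨z.2, h1⟩, h2⟩, ofCoords_coords z⟩

theorem horizontalPart_Iic_lt_top (μ : Measure ClosedRHP) [IsFiniteMeasureOnCompacts μ] (N : ℝ) :
    horizontalPart μ (Set.Iic N) < ∞ := by
  rw [horizontalPart_apply μ measurableSet_Iic]
  refine lt_of_le_of_lt (measure_mono ?_)
    (measure_bounded_rect_lt_top N (isCompact_Icc (a := (0 : ℝ)) (b := 1)))
  rintro z ⟨h1, h2⟩
  exact ⟨h1, Set.Ico_subset_Icc_self h2⟩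

theorem sigmaFinite_horizontalPart (μ : Measure ClosedRHP) [IsFiniteMeasureOnCompacts μ] :
    SigmaFinite (horizontalPart μ) := by
  have : IsFiniteMeasureOnCompacts (horizontalPart μ) := by
    refine ⟨fun K hK => ?_⟩
    obtain ⟨N, hN⟩ := hK.bddAbove
    exact (measure_mono fun x hx => hN hx).trans_lt (horizontalPart_Iic_lt_top μ N)
  infer_instance

theorem ae_nonneg_horizontalPart (μ : Measure ClosedRHP) : ∀ᵐ x ∂horizontalPart μ, 0 ≤ x := by
  rw [horizontalPart, ae_map_iff measurable_re.aemeasurable measurableSet_Ici]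
  exact ae_of_all _ fun z => z.2

/-- Over a bounded set of abscissas a translation invariant measure is a multiple of Lebesgue
measure, by uniqueness of Haar measure on `ℝ`. -/
theorem TranslationInvariant.measure_rect_of_le {μ : Measure ClosedRHP}
    [IsFiniteMeasureOnCompacts μ] (hμ : TranslationInvariant μ) {A B : Set ℝ}
    (hA : MeasurableSet A) {N : ℝ} (hAN : A ⊆ Set.Iic N) (hB : MeasurableSet B) :
    μ {z | z.1.re ∈ A ∧ z.1.im ∈ B} = horizontalPart μ A * volume B := by
  set κ : Measure ℝ := (μ.restrict {z | z.1.re ∈ A}).map fun z => z.1.im with hκ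
  have hκa : ∀ B, MeasurableSet B → κ B = μ {z | z.1.re ∈ A ∧ z.1.im ∈ B} := by
    intro B hB
    rw [hκ, Measure.map_apply measurable_im hB, Measure.restrict_apply (measurable_im hB)]
    congr 1
    ext z
    exact and_comm
  have hinv : κ.IsAddLeftInvariant := by
    refine ⟨fun c => ?_⟩
    ext B hB
    have hm : Measurable fun x : ℝ => c + x := measurable_const_add c
    rw [Measure.map_apply hm hB, hκa _ (hm hB), hκa _ hB]
    conv_rhs => rw [← hμ c]
    have hmeas : MeasurableSet {z : ClosedRHP | z.1.re ∈ A ∧ z.1.im ∈ B} :=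
      (measurable_re hA).inter (measurable_im hB)
    rw [Measure.map_apply (continuous_translate c).measurable hmeas]
    congr 1
    ext z
    change _ ∧ c + z.1.im ∈ B ↔ _ ∧ z.1.im + c ∈ B
    rw [add_comm]
    rfl
  have hfin : IsFiniteMeasureOnCompacts κ := by
    refine ⟨fun K hK => ?_⟩
    rw [hκa _ hK.measurableSet]
    refine lt_of_le_of_lt (measure_mono ?_) (measure_bounded_rect_lt_top N hK)
    rintro z ⟨h1, h2⟩
    exact ⟨hAN h1, h2⟩
  have h := Measure.isAddLeftInvariant_eq_smul κ volume
  set c := Measure.addHaarScalarFactor κ volume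
  have h1 : κ (Set.Ico 0 1) = c := by rw [h]; simp
  rw [horizontalPart_apply μ hA, ← hκa _ measurableSet_Ico, ← hκa _ hB, h1]
  conv_lhs => rw [h]
  rfl

theorem TranslationInvariant.measure_rect {μ : Measure ClosedRHP}
    [IsFiniteMeasureOnCompacts μ] (hμ : TranslationInvariant μ) {A B : Set ℝ}
    (hA : MeasurableSet A) (hB : MeasurableSet B) :
    μ {z | z.1.re ∈ A ∧ z.1.im ∈ B} = horizontalPart μ A * volume B := by
  have hU : A = ⋃ N : ℕ, A ∩ Set.Iic (N : ℝ) := by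
    ext x
    simpa using fun _ => exists_nat_ge x
  have hmono : Monotone fun N : ℕ => A ∩ Set.Iic (N : ℝ) := fun m n hmn =>
    Set.inter_subset_inter_right _ (Set.Iic_subset_Iic.mpr (by exact_mod_cast hmn))
  have hset : {z : ClosedRHP | z.1.re ∈ A ∧ z.1.im ∈ B} =
      ⋃ N : ℕ, {z : ClosedRHP | z.1.re ∈ A ∩ Set.Iic (N : ℝ) ∧ z.1.im ∈ B} := by
    ext z
    simpa using fun _ _ => exists_nat_ge z.1.re
  have hmono' : Monotone fun N : ℕ =>
      {z : ClosedRHP | z.1.re ∈ A ∩ Set.Iic (N : ℝ) ∧ z.1.im ∈ B} :=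
    fun m n hmn z hz => ⟨hmono hmn hz.1, hz.2⟩
  rw [hset, hmono'.measure_iUnion]
  conv_rhs => rw [hU, hmono.measure_iUnion, ENNReal.iSup_mul]
  refine iSup_congr fun N => ?_
  exact hμ.measure_rect_of_le (hA.inter measurableSet_Iic) Set.inter_subset_right hB

theorem TranslationInvariant.eq_map_prod {μ : Measure ClosedRHP}
    [IsFiniteMeasureOnCompacts μ] (hμ : TranslationInvariant μ) :
    μ = ((horizontalPart μ).prod volume).map ofCoords := by
  have := sigmaFinite_horizontalPart μ
  have hm : Measurable fun z : ClosedRHP => (z.1.re, z.1.im) := measurable_re.prodMk measurable_im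
  have h : (horizontalPart μ).prod volume = μ.map fun z => (z.1.re, z.1.im) := by
    refine Measure.prod_eq fun s t hs ht => ?_
    rw [Measure.map_apply hm (hs.prod ht), ← hμ.measure_rect hs ht]
    rfl
  rw [h, Measure.map_map continuous_ofCoords.measurable hm]
  have : ofCoords ∘ (fun z : ClosedRHP => (z.1.re, z.1.im)) = id := funext ofCoords_coords
  rw [this, Measure.map_id]

/-- A finite measure on the line is determined by its Laplace transform to the left of some
`b > 0`, because the latter continues analytically to the imaginary axis. -/
theorem ext_of_lintegral_exp {ρ₁ ρ₂ : Measure ℝ} [IsFiniteMeasure ρ₁] [IsFiniteMeasure ρ₂] {b : ℝ}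
    (hb : 0 < b)
    (h : ∀ t < b, ∫⁻ x, ENNReal.ofReal (Real.exp (t * x)) ∂ρ₁ =
      ∫⁻ x, ENNReal.ofReal (Real.exp (t * x)) ∂ρ₂)
    (hfin : ∀ t < b, ∫⁻ x, ENNReal.ofReal (Real.exp (t * x)) ∂ρ₁ ≠ ∞) : ρ₁ = ρ₂ := by
  have hsub : ∀ ρ : Measure ℝ,
      (∀ t < b, ∫⁻ x, ENNReal.ofReal (Real.exp (t * x)) ∂ρ ≠ ∞) →
      {z : ℂ | z.re < b} ⊆ {z | z.re ∈ interior (ProbabilityTheory.integrableExpSet id ρ)} := by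
    intro ρ hρ
    have : Set.Iio b ⊆ ProbabilityTheory.integrableExpSet id ρ := by
      intro t ht
      refine ⟨by fun_prop, ?_⟩
      rw [hasFiniteIntegral_iff_ofReal (ae_of_all _ fun x => (Real.exp_pos _).le)]
      exact (hρ t ht).lt_top
    intro z hz
    exact interior_maximal this isOpen_Iio hz
  have hfin₂ : ∀ t < b, ∫⁻ x, ENNReal.ofReal (Real.exp (t * x)) ∂ρ₂ ≠ ∞ := fun t ht =>
    h t ht ▸ hfin t ht
  have h1 := (ProbabilityTheory.analyticOnNhd_complexMGF (X := id) (μ := ρ₁)).mono (hsub ρ₁ hfin)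
  have h2 := (ProbabilityTheory.analyticOnNhd_complexMGF (X := id) (μ := ρ₂)).mono (hsub ρ₂ hfin₂)
  have hreal : ∀ t : ℝ, t < b →
      ProbabilityTheory.complexMGF id ρ₁ t = ProbabilityTheory.complexMGF id ρ₂ t := by
    intro t ht
    rw [ProbabilityTheory.complexMGF_ofReal, ProbabilityTheory.complexMGF_ofReal,
      ProbabilityTheory.mgf, ProbabilityTheory.mgf,
      integral_eq_lintegral_of_nonneg_ae (ae_of_all _ fun x => (Real.exp_pos _).le) (by fun_prop),
      integral_eq_lintegral_of_nonneg_ae (ae_of_all _ fun x => (Real.exp_pos _).le) (by fun_prop)]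
    exact congrArg (fun r : ℝ≥0∞ => ((r.toReal : ℝ) : ℂ)) (h t ht)
  have heq := AnalyticOnNhd.eqOn_of_preconnected_of_frequently_eq h1 h2
    (convex_halfSpace_re_lt b).isPreconnected (z₀ := 0) (by simpa using hb) (by
      rw [frequently_iff_seq_forall]
      refine ⟨fun n : ℕ => ((-(1 / ((n : ℝ) + 1)) : ℝ) : ℂ), ?_, fun n => hreal _ ?_⟩
      · rw [tendsto_nhdsWithin_iff]
        constructor
        · have := (tendsto_one_div_add_atTop_nhds_zero_nat (𝕜 := ℝ)).neg
          rw [neg_zero] at this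
          exact (Complex.continuous_ofReal.tendsto 0).comp this
        · refine Eventually.of_forall fun n => ?_
          have : (0 : ℝ) < 1 / ((n : ℝ) + 1) := by positivity
          rw [Set.mem_compl_singleton_iff, Ne, Complex.ofReal_eq_zero]
          linarith
      · have : (0 : ℝ) < 1 / ((n : ℝ) + 1) := by positivity
        linarith)
  refine Measure.ext_of_charFun (funext fun t => ?_)
  rw [← ProbabilityTheory.complexMGF_id_mul_I, ← ProbabilityTheory.complexMGF_id_mul_I]
  exact heq (by simpa using hb)

/-- The squared `L²` norm of the transform of `K_1` over the line with abscissa `x`. -/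
noncomputable def lineDensity (x : ℝ) : ℝ≥0∞ :=
  ∫⁻ y, ‖kernelTransform 1 (ofCoords (x, y))‖ₑ ^ 2

theorem measurable_enorm_sq_kernelTransform_ofCoords :
    Measurable fun p : ℝ × ℝ => ‖kernelTransform 1 (ofCoords p)‖ₑ ^ 2 :=
  (((continuous_kernelTransform one_ne_zero).comp continuous_ofCoords).measurable.enorm).pow_const 2

theorem measurable_lineDensity : Measurable lineDensity :=
  measurable_enorm_sq_kernelTransform_ofCoords.lintegral_prod_right'

theorem lineDensity_ne_zero (x : ℝ) : lineDensity x ≠ 0 := by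
  intro h
  have hm : Measurable fun y : ℝ => ‖kernelTransform 1 (ofCoords (x, y))‖ₑ ^ 2 :=
    measurable_enorm_sq_kernelTransform_ofCoords.comp measurable_prodMk_left
  rw [lineDensity, lintegral_eq_zero_iff hm] at h
  obtain ⟨y, hy⟩ := h.exists
  simp [kernelTransform_ne_zero one_ne_zero] at hy

theorem ofReal_exp_mem_disk {t : ℝ} (ht : t < 2 * Real.log 2) :
    ((Real.exp (t / 2) : ℝ) : ℂ) ∈ disk := by
  have h1 : Real.exp (t / 2) < 2 := by
    rw [← Real.lt_log_iff_exp_lt two_pos]; linarith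
  have h2 := Real.exp_pos (t / 2)
  rw [disk, Metric.mem_ball, dist_eq_norm, ← Complex.ofReal_one, ← Complex.ofReal_sub,
    Complex.norm_real, Real.norm_eq_abs, abs_lt]
  constructor <;> linarith

/-- Real parameters `w = e^{t/2}` of the kernel act on the transform by an exponential weight. -/
theorem enorm_sq_kernelTransform_ofReal_exp (t : ℝ) (z : ClosedRHP) :
    ‖kernelTransform ((Real.exp (t / 2) : ℝ) : ℂ) z‖ₑ ^ 2 * ENNReal.ofReal (Real.exp t) =
      ‖kernelTransform 1 z‖ₑ ^ 2 * ENNReal.ofReal (Real.exp (t * z.1.re)) := by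
  have h1 : ‖kernelTransform ((Real.exp (t / 2) : ℝ) : ℂ) z‖ₑ ^ 2 =
      ‖kernelTransform 1 z‖ₑ ^ 2 * ENNReal.ofReal (Real.exp (t * z.1.re - t)) := by
    simp only [kernelTransform, map_one, Complex.one_cpow, mul_one, Complex.conj_ofReal]
    rw [enorm_mul, mul_pow]
    congr 1
    rw [← ofReal_norm, Complex.norm_cpow_eq_rpow_re_of_pos (Real.exp_pos _),
      ← ENNReal.ofReal_pow (by positivity), ← Real.exp_mul, ← Real.exp_nat_mul]
    congr 2
    simp
    ring
  rw [h1, mul_assoc, ← ENNReal.ofReal_mul (Real.exp_pos _).le, ← Real.exp_add, sub_add_cancel]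

/-- The Laplace transform of the weighted horizontal part depends only on Bergman norms. -/
theorem lintegral_exp_horizontalPart {μ : Measure ClosedRHP} (hT : TranslationInvariant μ)
    (hP : PreservesInner μ) {t : ℝ} (ht : t < 2 * Real.log 2) :
    ∫⁻ x, ENNReal.ofReal (Real.exp (t * x)) ∂((horizontalPart μ).withDensity lineDensity) =
      ENNReal.ofReal (2 * Real.pi * (bergmanInner (bergmanKernel (Real.exp (t / 2) : ℝ))
        (bergmanKernel (Real.exp (t / 2) : ℝ))).re) * ENNReal.ofReal (Real.exp t) := by
  have := hP.isFiniteMeasureOnCompacts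
  have := sigmaFinite_horizontalPart μ
  have hw := ofReal_exp_mem_disk ht
  have hme : Measurable fun x : ℝ => ENNReal.ofReal (Real.exp (t * x)) := by fun_prop
  have hk : Measurable fun z : ClosedRHP =>
      ‖kernelTransform 1 z‖ₑ ^ 2 * ENNReal.ofReal (Real.exp (t * z.1.re)) :=
    ((continuous_kernelTransform one_ne_zero).measurable.enorm.pow_const 2).mul
      (hme.comp measurable_re)
  rw [← hP.lintegral_kernelTransform hw, ← lintegral_mul_const' _ _ ENNReal.ofReal_ne_top]
  simp only [enorm_sq_kernelTransform_ofReal_exp]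
  conv_rhs => rw [hT.eq_map_prod]
  have hk' : Measurable fun p : ℝ × ℝ => ‖kernelTransform 1 (ofCoords p)‖ₑ ^ 2 *
      ENNReal.ofReal (Real.exp (t * (ofCoords p).1.re)) := hk.comp continuous_ofCoords.measurable
  rw [lintegral_map hk continuous_ofCoords.measurable, lintegral_prod _ hk'.aemeasurable,
    lintegral_withDensity_eq_lintegral_mul _ measurable_lineDensity hme]
  refine lintegral_congr_ae ?_
  filter_upwards [ae_nonneg_horizontalPart μ] with x hx
  have hre : ∀ y, (ofCoords (x, y)).1.re = x := fun y => max_eq_left hx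
  simp only [hre, Pi.mul_apply]
  rw [lintegral_mul_const' _ _ ENNReal.ofReal_ne_top]
  rfl

/-- Two measures with both properties coincide. -/
theorem eq_of_translationInvariant_of_preservesInner {μ₁ μ₂ : Measure ClosedRHP}
    (hT₁ : TranslationInvariant μ₁) (hP₁ : PreservesInner μ₁)
    (hT₂ : TranslationInvariant μ₂) (hP₂ : PreservesInner μ₂) : μ₁ = μ₂ := by
  have := hP₁.isFiniteMeasureOnCompacts
  have := hP₂.isFiniteMeasureOnCompacts
  have hlog : 0 < 2 * Real.log 2 := by have := Real.log_pos one_lt_two; linarith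
  have hmass : ∀ μ, TranslationInvariant μ → PreservesInner μ →
      ((horizontalPart μ).withDensity lineDensity) Set.univ < ∞ := by
    intro μ hT hP
    have h := lintegral_exp_horizontalPart hT hP hlog
    simp only [zero_mul, Real.exp_zero, ENNReal.ofReal_one, lintegral_one, mul_one] at h
    rw [h]
    exact ENNReal.ofReal_lt_top
  have : IsFiniteMeasure ((horizontalPart μ₁).withDensity lineDensity) := ⟨hmass μ₁ hT₁ hP₁⟩
  have : IsFiniteMeasure ((horizontalPart μ₂).withDensity lineDensity) := ⟨hmass μ₂ hT₂ hP₂⟩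
  have hρ : (horizontalPart μ₁).withDensity lineDensity =
      (horizontalPart μ₂).withDensity lineDensity := by
    refine ext_of_lintegral_exp hlog (fun t ht => ?_) fun t ht => ?_
    · rw [lintegral_exp_horizontalPart hT₁ hP₁ ht, lintegral_exp_horizontalPart hT₂ hP₂ ht]
    · rw [lintegral_exp_horizontalPart hT₁ hP₁ ht]
      exact ENNReal.mul_ne_top ENNReal.ofReal_ne_top ENNReal.ofReal_ne_top
  have hinv : ∀ μ, TranslationInvariant μ → PreservesInner μ →
      ((horizontalPart μ).withDensity lineDensity).withDensity (lineDensity)⁻¹ =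
        horizontalPart μ := by
    intro μ hT hP
    refine withDensity_inv_same measurable_lineDensity (ae_of_all _ lineDensity_ne_zero) ?_
    have h := hmass μ hT hP
    rw [withDensity_apply _ MeasurableSet.univ, setLIntegral_univ] at h
    exact (ae_lt_top measurable_lineDensity h.ne).mono fun x hx => hx.ne
  rw [hT₁.eq_map_prod, hT₂.eq_map_prod, ← hinv μ₁ hT₁ hP₁, ← hinv μ₂ hT₂ hP₂, hρ]

end MellinBergman

theorem mainTheorem5 :
    (∀ f : ℂ → ℂ, MellinBergman.IsBergman f →
      ∃ F : MellinBergman.ClosedRHP → ℂ,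
        MellinBergman.IsBoundaryExtension (MellinBergman.weightedTransform f) F) ∧
    (∀ μ : Measure MellinBergman.ClosedRHP,
      (MellinBergman.TranslationInvariant μ ∧ MellinBergman.PreservesInner μ) ↔
        μ = MellinBergman.omega) := by
  obtain ⟨Ψ, hΨ, -⟩ := MellinBergman.exists_isSpectrum
  refine ⟨fun f hf => (hΨ f hf).exists_isBoundaryExtension, fun μ => ⟨fun h => ?_, ?_⟩⟩
  · exact MellinBergman.eq_of_translationInvariant_of_preservesInner h.1 h.2
      MellinBergman.translationInvariant_omega MellinBergman.preservesInner_omega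
  · rintro rfl
    exact ⟨MellinBergman.translationInvariant_omega, MellinBergman.preservesInner_omega⟩
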